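/- Let $K$ be an infinite field, $n\ge 0$, and let $S=K[x_1,\dots,x_n]$ be the standard graded polynomial ring. A matrix $g=(a_{kl})\in \mathrm{GL}_n(K)$ acts on $S$ as the change of coordinates $g(x_i)=\sum_{k=1}^n a_{ki}x_k$. A property holds for a general $g$ if it holds for all $g$ in some non-empty Zariski open subset of $\mathrm{GL}_n(K)$. Let $>_{\mathrm{lex}}$ be the lexicographic order on the monomials of $S$ induced by $x_1>\cdots>x_n$, and let $>_{\mathrm{oplex}}$ be the lexicographic order induced by $x_n>\cdots>x_1$. For a term order $\sigma$ and a homogeneous ideal $I\subset S$, the generic initial ideal $\mathrm{Gin}_\sigma(I)$ is the monomial ideal that equals the initial ideal $\mathrm{in}_\sigma(g(I))$ for a general $g$. Let $I,J\subset S$ be homogeneous ideals and fix a degree $j\ge 0$ (in negative degrees all the spaces below are zero). For a general $g\in\mathrm{GL}_n(K)$ one has, with the graded modules $\mathrm{Tor}_i=\mathrm{Tor}_i^S$: (i) $\dim_K \mathrm{Tor}_i(S/I,\,S/g(J))_j\le \dim_K \mathrm{Tor}_i(S/\mathrm{Gin}_{\mathrm{lex}}(I),\,S/\mathrm{Gin}_{\mathrm{oplex}}(J))_j$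 for all $i\ge 0$; (ii) $\dim_K \mathrm{Tor}_i(I,\,S/g(J))_j\le \dim_K \mathrm{Tor}_i(\mathrm{Gin}_{\mathrm{lex}}(I),\,S/\mathrm{Gin}_{\mathrm{oplex}}(J))_j$ for all $i\ge 0$. -/

import Mathlib

open scoped TensorProduct

universe u

noncomputable section

namespace GenTor

/-! # Orders on monomials, initial ideals, changes of coordinates, generic initial ideals -/

/-- The opposite lexicographic order on the monomials in `x_0, …, x_{n-1}`: the lexicographic
order induced by `x_{n-1} > ⋯ > x_0`. (`MonomialOrder.lex` on `Fin n` is the lexicographic order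
induced by `x_0 > ⋯ > x_{n-1}`.) -/
def oplex (n : ℕ) : MonomialOrder (Fin n) where
  syn := Colex (Fin n →₀ ℕ)
  toSyn := { toEquiv := toColex, map_add' := toColex_add }
  toSyn_monotone := Finsupp.toColex_monotone

/-- The comparison of exponent vectors in the lexicographic order. -/
theorem lex_lt_iff {n : ℕ} {a b : Fin n →₀ ℕ} :
    (MonomialOrder.lex (σ := Fin n)).toSyn a < MonomialOrder.lex.toSyn b ↔
      ∃ i, (∀ k, k < i → a k = b k) ∧ a i < b i :=
  Finsupp.Lex.lt_iff

/-- The comparison of exponent vectors in the opposite lexicographic order. -/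
theorem oplex_lt_iff {n : ℕ} {a b : Fin n →₀ ℕ} :
    (oplex n).toSyn a < (oplex n).toSyn b ↔ ∃ i, (∀ k, i < k → a k = b k) ∧ a i < b i :=
  Finsupp.Colex.lt_iff

section Gin

attribute [local instance] MvPolynomial.gradedAlgebra

variable {K : Type u} [Field K] {n : ℕ}

/-- A homogeneous ideal of the standard graded polynomial ring. -/
abbrev IsHomog (I : Ideal (MvPolynomial (Fin n) K)) : Prop :=
  I.IsHomogeneous (MvPolynomial.homogeneousSubmodule (Fin n) K)

/-- The initial ideal of `I`: the ideal generated by the leading terms of the elements of `I`. -/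
def initialIdeal (m : MonomialOrder (Fin n)) (I : Ideal (MvPolynomial (Fin n) K)) :
    Ideal (MvPolynomial (Fin n) K) :=
  Ideal.span (m.leadingTerm '' (I : Set (MvPolynomial (Fin n) K)))

/-- The change of coordinates attached to `g = (a_{kl})`: `x_i ↦ ∑_k a_{ki} x_k`. -/
def coordChange (g : GL (Fin n) K) : MvPolynomial (Fin n) K →ₐ[K] MvPolynomial (Fin n) K :=
  MvPolynomial.aeval fun i => ∑ k, MvPolynomial.C (g k i) * MvPolynomial.X k

/-- The ideal `g(I)`. -/
def actIdeal (g : GL (Fin n) K) (I : Ideal (MvPolynomial (Fin n) K)) :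
    Ideal (MvPolynomial (Fin n) K) :=
  I.map (coordChange g)

/-- Zariski open subsets of `GL_n(K)`: the sets where some member of a given set of polynomials
in the matrix entries does not vanish. -/
def IsZariskiOpen (U : Set (GL (Fin n) K)) : Prop :=
  ∃ F : Set (MvPolynomial (Fin n × Fin n) K),
    U = {g | ∃ f ∈ F, MvPolynomial.eval (fun p => g p.1 p.2) f ≠ 0}

/-- `P` holds for a general `g ∈ GL_n(K)`: it holds on a non-empty Zariski open subset. -/
def ForGeneral (P : GL (Fin n) K → Prop) : Prop :=
  ∃ U : Set (GL (Fin n) K), IsZariskiOpen U ∧ U.Nonempty ∧ ∀ g ∈ U, P g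

/-- The generic initial ideal of `I`: the ideal generated by the monomials that lie in the initial
ideal of `g(I)` for a general `g`. By `gin_eq` below it is the ideal that equals the
initial ideal of `g(I)` for a general `g`. -/
def gin (m : MonomialOrder (Fin n)) (I : Ideal (MvPolynomial (Fin n) K)) :
    Ideal (MvPolynomial (Fin n) K) :=
  Ideal.span {t | ∃ a : Fin n →₀ ℕ, t = MvPolynomial.monomial a (1 : K) ∧
    ForGeneral fun g => t ∈ initialIdeal m (actIdeal g I)}

/-- Over an infinite field two properties that hold for a general `g` hold simultaneously for
some `g`. -/
theorem ForGeneral.exists_and [Infinite K] {P Q : GL (Fin n) K → Prop}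
    (hP : ForGeneral P) (hQ : ForGeneral Q) : ∃ g, P g ∧ Q g := by
  obtain ⟨_, ⟨F, rfl⟩, ⟨g₁, f₁, hf₁, h₁⟩, hP⟩ := hP
  obtain ⟨_, ⟨F', rfl⟩, ⟨g₂, f₂, hf₂, h₂⟩, hQ⟩ := hQ
  let D : MvPolynomial (Fin n × Fin n) K :=
    (Matrix.of fun i k => (MvPolynomial.X (i, k) : MvPolynomial (Fin n × Fin n) K)).det
  have hD : ∀ v : Fin n × Fin n → K, MvPolynomial.eval v D =
      (Matrix.of fun i k => v (i, k)).det := by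
    intro v
    simp only [D, RingHom.map_det]
    congr 1
    ext i k
    simp
  have hD0 : D ≠ 0 := by
    intro h
    have := hD fun p => (1 : Matrix (Fin n) (Fin n) K) p.1 p.2
    rw [h] at this
    have h1 : (Matrix.of fun i k => (1 : Matrix (Fin n) (Fin n) K) i k) = 1 := rfl
    simp [h1] at this
  have hne : f₁ * f₂ * D ≠ 0 := by
    refine mul_ne_zero (mul_ne_zero ?_ ?_) hD0
    · rintro rfl; simp at h₁
    · rintro rfl; simp at h₂
  obtain ⟨v, hv⟩ : ∃ v, MvPolynomial.eval v (f₁ * f₂ * D) ≠ 0 := by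
    by_contra! h
    exact hne (MvPolynomial.funext fun v => by simpa using h v)
  rw [map_mul, map_mul] at hv
  have hdet : (Matrix.of fun i k => v (i, k)).det ≠ 0 := by
    rw [← hD]; exact right_ne_zero_of_mul hv
  refine ⟨Matrix.GeneralLinearGroup.mkOfDetNeZero _ hdet, hP _ ⟨f₁, hf₁, ?_⟩,
    hQ _ ⟨f₂, hf₂, ?_⟩⟩
  · exact left_ne_zero_of_mul (left_ne_zero_of_mul hv)
  · exact right_ne_zero_of_mul (left_ne_zero_of_mul hv)

/-- If the initial ideal of `g(I)` is `L` for a general `g`, then `L` is `gin m I`. -/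
theorem gin_eq [Infinite K] {m : MonomialOrder (Fin n)} {I L : Ideal (MvPolynomial (Fin n) K)}
    (h : ForGeneral fun g => initialIdeal m (actIdeal g I) = L) : gin m I = L := by
  apply le_antisymm
  · refine Ideal.span_le.2 ?_
    rintro _ ⟨a, rfl, ha⟩
    obtain ⟨g, h1, h2⟩ := ForGeneral.exists_and h ha
    exact h1 ▸ h2
  · obtain ⟨g, hg, -⟩ := ForGeneral.exists_and h h
    rw [← hg, initialIdeal, MonomialOrder.span_leadingTerm_eq_span_monomial']
    refine Ideal.span_le.2 ?_
    rintro _ ⟨f, hf, rfl⟩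
    refine Ideal.subset_span ⟨_, rfl, ?_⟩
    obtain ⟨U, hU, hne, hUL⟩ := h
    refine ⟨U, hU, hne, fun g' hg' => ?_⟩
    have h1 : initialIdeal m (actIdeal g' I) = initialIdeal m (actIdeal g I) :=
      (hUL g' hg').trans hg.symm
    change _ ∈ initialIdeal m (actIdeal g' I)
    rw [h1, initialIdeal, MonomialOrder.span_leadingTerm_eq_span_monomial']
    exact Ideal.subset_span ⟨f, hf, rfl⟩

end Gin

/-! # Graded modules and graded Tor -/

/-- A module over `S = K[x_0, …, x_{n-1}]` together with its graded pieces `gr d`, `d ≥ 0`.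
It is only used for the modules `S/I` and `I` with `I` a homogeneous ideal, and for those built
from them below, on all of which `gr` is a grading. -/
structure GrMod (K : Type u) [Field K] (n : ℕ) : Type (u + 1) where
  carrier : Type u
  [addCommGroup : AddCommGroup carrier]
  [moduleK : Module K carrier]
  [moduleS : Module (MvPolynomial (Fin n) K) carrier]
  [tower : IsScalarTower K (MvPolynomial (Fin n) K) carrier]
  gr : ℕ → Submodule K carrier

attribute [instance] GrMod.addCommGroup GrMod.moduleK GrMod.moduleS GrMod.tower

variable {K : Type u} [Field K] {n : ℕ}

/-- The module `S/I`, with `(S/I)_d` the image of `S_d`. -/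
def quotMod (I : Ideal (MvPolynomial (Fin n) K)) : GrMod K n where
  carrier := MvPolynomial (Fin n) K ⧸ I
  gr d := (MvPolynomial.homogeneousSubmodule (Fin n) K d).map (Ideal.Quotient.mkₐ K I).toLinearMap

/-- The ideal `I` as a module, with `I_d = I ∩ S_d`. -/
def idealMod (I : Ideal (MvPolynomial (Fin n) K)) : GrMod K n where
  carrier := I
  gr d := (MvPolynomial.homogeneousSubmodule (Fin n) K d).comap (I.subtype.restrictScalars K)

/-- The free `S`-module `S ⊗_K M` on the graded vector space `M`, graded by total degree. -/
def freeOn (M : GrMod K n) : GrMod K n where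
  carrier := MvPolynomial (Fin n) K ⊗[K] M.carrier
  gr d := Submodule.span K {t | ∃ a b : ℕ, a + b = d ∧
    ∃ s ∈ MvPolynomial.homogeneousSubmodule (Fin n) K a, ∃ x ∈ M.gr b, t = s ⊗ₜ[K] x}

/-- The surjection `S ⊗_K M → M`, `s ⊗ x ↦ s x`. -/
def cover (M : GrMod K n) : (freeOn M).carrier →ₗ[MvPolynomial (Fin n) K] M.carrier :=
  TensorProduct.AlgebraTensorModule.lift
    ((LinearMap.lsmul (MvPolynomial (Fin n) K) M.carrier).flip.restrictScalars K).flip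

/-- The first syzygy module of `M`: the kernel of `S ⊗_K M → M`, with the induced grading. -/
def syz (M : GrMod K n) : GrMod K n where
  carrier := LinearMap.ker (cover M)
  gr d := ((freeOn M).gr d).comap ((LinearMap.ker (cover M)).subtype.restrictScalars K)

/-- The inclusion of the first syzygy module of `M` into `S ⊗_K M`. -/
def syzIncl (M : GrMod K n) :
    (syz M).carrier →ₗ[MvPolynomial (Fin n) K] (freeOn M).carrier :=
  (LinearMap.ker (cover M)).subtype

theorem syzIncl_injective (M : GrMod K n) : Function.Injective (syzIncl M) :=
  (LinearMap.ker (cover M)).subtype_injective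

theorem range_syzIncl (M : GrMod K n) :
    LinearMap.range (syzIncl M) = LinearMap.ker (cover M) :=
  (LinearMap.ker (cover M)).range_subtype

@[simp]
theorem cover_tmul (M : GrMod K n) (s : MvPolynomial (Fin n) K) (x : M.carrier) :
    cover M (s ⊗ₜ[K] x) = s • x :=
  rfl

theorem cover_surjective (M : GrMod K n) : Function.Surjective (cover M) := fun x =>
  ⟨(1 : MvPolynomial (Fin n) K) ⊗ₜ[K] x, by simp⟩

/-- The `i`-th syzygy module of `M`. -/
def syzIter (M : GrMod K n) : ℕ → GrMod K n
  | 0 => M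
  | i + 1 => syz (syzIter M i)

/-- The terms of a graded free resolution `⋯ → F_1 → F_0 → M → 0` of `M`, obtained by
repeatedly covering the kernel of the previous map by a free module. -/
abbrev res (M : GrMod K n) (i : ℕ) : GrMod K n :=
  freeOn (syzIter M i)

/-- The differential `F_{i+1} → F_i` of the resolution. -/
def resD (M : GrMod K n) (i : ℕ) :
    (res M (i + 1)).carrier →ₗ[MvPolynomial (Fin n) K] (res M i).carrier :=
  syzIncl (syzIter M i) ∘ₗ cover (syzIter M (i + 1))

/-- The terms of the resolution are free. -/
theorem res_free (M : GrMod K n) (i : ℕ) :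
    Module.Free (MvPolynomial (Fin n) K) (res M i).carrier :=
  inferInstanceAs (Module.Free (MvPolynomial (Fin n) K)
    (MvPolynomial (Fin n) K ⊗[K] (syzIter M i).carrier))

theorem range_resD (M : GrMod K n) (i : ℕ) :
    LinearMap.range (resD M i) = LinearMap.ker (cover (syzIter M i)) := by
  have h : LinearMap.range (cover (syzIter M (i + 1))) = ⊤ :=
    LinearMap.range_eq_top.2 (cover_surjective _)
  exact (LinearMap.range_comp_of_range_eq_top _ h).trans (range_syzIncl _)

/-- The resolution is exact at `F_0`, where the augmentation is `cover M : F_0 → M`. -/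
theorem res_exact_zero (M : GrMod K n) : LinearMap.range (resD M 0) = LinearMap.ker (cover M) :=
  range_resD M 0

/-- The resolution is exact at `F_{i+1}`. -/
theorem res_exact_succ (M : GrMod K n) (i : ℕ) :
    LinearMap.range (resD M (i + 1)) = LinearMap.ker (resD M i) := by
  have h : LinearMap.ker (syzIncl (syzIter M i)) = ⊥ :=
    LinearMap.ker_eq_bot.2 (syzIncl_injective _)
  exact (range_resD M (i + 1)).trans (LinearMap.ker_comp_of_ker_eq_bot _ h).symm

/-- The term `F_i ⊗_S N` of the complex `F ⊗_S N`. -/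
abbrev torTerm (M N : GrMod K n) (i : ℕ) : Type u :=
  (res M i).carrier ⊗[MvPolynomial (Fin n) K] N.carrier

/-- The degree `j` piece of `F_i ⊗_S N`. -/
def torTermGr (M N : GrMod K n) (i j : ℕ) : Submodule K (torTerm M N i) :=
  Submodule.span K {t | ∃ a b : ℕ, a + b = j ∧
    ∃ x ∈ (res M i).gr a, ∃ y ∈ N.gr b, t = x ⊗ₜ[MvPolynomial (Fin n) K] y}

/-- The differential `F_{i+1} ⊗_S N → F_i ⊗_S N`. -/
def torD (M N : GrMod K n) (i : ℕ) :
    torTerm M N (i + 1) →ₗ[MvPolynomial (Fin n) K] torTerm M N i :=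
  (resD M i).rTensor N.carrier

/-- The cycles of `F ⊗_S N`. -/
def torCycles (M N : GrMod K n) :
    (i : ℕ) → Submodule (MvPolynomial (Fin n) K) (torTerm M N i)
  | 0 => ⊤
  | i + 1 => LinearMap.ker (torD M N i)

/-- The boundaries are cycles. -/
theorem range_torD_le (M N : GrMod K n) (i : ℕ) :
    LinearMap.range (torD M N i) ≤ torCycles M N i := by
  cases i with
  | zero => exact le_top
  | succ i =>
    have h : resD M i ∘ₗ resD M (i + 1) = 0 :=
      LinearMap.range_le_ker_iff.1 (res_exact_succ M i).le
    refine LinearMap.range_le_ker_iff.2 ?_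
    rw [torD, torD, ← LinearMap.rTensor_comp, h, LinearMap.rTensor_zero]

/-- The `S`-module `Tor_i^S(M, N)`: the `i`-th homology of `F ⊗_S N`. -/
abbrev Tor (M N : GrMod K n) (i : ℕ) : Type u :=
  torCycles M N i ⧸ (LinearMap.range (torD M N i)).submoduleOf (torCycles M N i)

/-- The graded piece `Tor_i^S(M, N)_j`: the classes of the cycles of degree `j`. -/
def torGr (M N : GrMod K n) (i j : ℕ) : Submodule K (Tor M N i) :=
  ((torTermGr M N i j).comap ((torCycles M N i).subtype.restrictScalars K)).map
    (((LinearMap.range (torD M N i)).submoduleOf (torCycles M N i)).mkQ.restrictScalars K)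

/-- `dim_K Tor_i^S(M, N)_j`. -/
def torDim (M N : GrMod K n) (i j : ℕ) : Cardinal.{u} :=
  Module.rank K (torGr M N i j)

end GenTor

end

noncomputable section

namespace GenTor

/-! # Graded vector spaces -/

section Graded

variable {K : Type*} [Field K] {V W V' W' : Type*} [AddCommGroup V] [Module K V]
  [AddCommGroup W] [Module K W] [AddCommGroup V'] [Module K V'] [AddCommGroup W'] [Module K W']

/-! The inequality is semicontinuity of Tor, used twice: once along a one-parameter degeneration and
once on the general linear group.

Tor is computed from the resolution with terms `S ⊗_K syz^i(M)`. After tensoring with `N` over `S`,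
the `i`-th term becomes the vector space `syz^i(M) ⊗_K N` (`freeTensorEquiv`). Its degree `j` piece
is finite-dimensional, and its dimension depends only on the Hilbert functions of `M` and `N` up to
degree `j` (`finrank_syzTgr_congr`). The dimension of Tor is the dimension of this term minus the
ranks of the adjacent differentials. With equal Hilbert functions, smaller ranks therefore mean
larger Tor (`torDim_le_of_torRank_le`).

A family of subspaces "lifts" at a point if every vector over that point extends to a polynomial
section of the family. Determinants show that the dimension of such a family cannot drop near the
point (`Lifts.finrank_le`). Tensor products, sums and fixed linear images preserve lifting, so it
passes from the graded pieces of the ideals to the syzygies and then to the ranks of the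
differentials. Hence for families of homogeneous ideals with constant Hilbert function, Tor at a
special point bounds Tor at all nearby points (`exists_torDim_le`).

Up to degree `j`, the generic initial ideals are the initial ideals of `h₁(I)` and `h₂(J)` for
suitable `h₁`, `h₂` (`exists_gin_eq`). Weights representing the two orders in degrees at most `j`
give diagonal one-parameter groups that degenerate `h₁(I)` and `h₂(J)` to them simultaneously as the
parameter `t` tends to 0 (`lifts_degeneration`). At some `t ≠ 0` this bounds Tor of `u₁(I)` and
`u₂(J)`, where `u₁`, `u₂` are invertible. Undoing `u₁` on both sides gives the inequality for the
single matrix `u₁⁻¹ * u₂`. Semicontinuity for the family `g ↦ g(J)` then spreads it to general `g`.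
The two orders enter only through the weights that represent them. -/

theorem finrank_map_add_finrank_inf_ker (f : V →ₗ[K] W) (p : Submodule K V)
    [FiniteDimensional K p] :
    Module.finrank K (p.map f) + Module.finrank K (p ⊓ LinearMap.ker f : Submodule K V) =
      Module.finrank K p := by
  have h := LinearMap.finrank_range_add_finrank_ker (f.domRestrict p)
  rw [LinearMap.range_domRestrict, LinearMap.ker_domRestrict] at h
  rw [← h, ← Submodule.map_comap_subtype,
    (Submodule.equivMapOfInjective _ p.subtype_injective _).finrank_eq]

/-- `A` is a grading of `V` with finite-dimensional pieces. -/
structure IsGrading (A : ℕ → Submodule K V) : Prop where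
  indep : iSupIndep A
  iSup_eq_top : iSup A = ⊤
  fin : ∀ d, FiniteDimensional K (A d)

theorem IsGrading.exists_sum {A : ℕ → Submodule K V} (hA : iSup A = ⊤) (x : V) :
    ∃ (s : Finset ℕ) (v : ℕ → V), (∀ d, v d ∈ A d) ∧ x = ∑ d ∈ s, v d := by
  obtain ⟨f, hf, rfl⟩ := (Submodule.mem_iSup_iff_exists_finsupp A x).1 (hA ▸ Submodule.mem_top)
  exact ⟨f.support, f, hf, rfl⟩

/-- If a sum of elements of distinct degrees is homogeneous, it is the summand of that degree. -/
theorem IsGrading.sum_eq {A : ℕ → Submodule K V} (hA : iSupIndep A) {s : Finset ℕ} {v : ℕ → V}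
    (hv : ∀ d, v d ∈ A d) {j : ℕ} (h : ∑ d ∈ s, v d ∈ A j) :
    ∑ d ∈ s, v d = if j ∈ s then v j else 0 := by
  classical
  rw [iSupIndep_iff_finsetSum_eq_zero_imp_eq_zero] at hA
  -- The relation is the given sum minus its own value placed in degree `j`. Inserting `j` also
  -- covers `j ∉ s`, where the sum must vanish.
  have key := hA (insert j s)
    (fun d => (if d ∈ s then v d else 0) - if d = j then ∑ d ∈ s, v d else 0) (by
      intro i _
      refine Submodule.sub_mem _ ?_ ?_
      · split_ifs
        exacts [hv i, Submodule.zero_mem _]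
      · split_ifs with hij
        exacts [hij ▸ h, Submodule.zero_mem _]) (by
      rw [Finset.sum_sub_distrib, Finset.sum_ite_eq' , if_pos (Finset.mem_insert_self _ _),
        Finset.sum_ite_mem, Finset.inter_eq_right.2 (Finset.subset_insert _ _), sub_self])
    j (Finset.mem_insert_self _ _)
  simp only [if_true] at key
  exact (sub_eq_zero.1 key).symm

theorem IsGrading.eq_zero_of_sum_eq_zero {A : ℕ → Submodule K V} (hA : iSupIndep A)
    {s : Finset ℕ} {v : ℕ → V} (hv : ∀ d, v d ∈ A d) (h : ∑ d ∈ s, v d = 0) :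
    ∀ d ∈ s, v d = 0 :=
  (iSupIndep_iff_finsetSum_eq_zero_imp_eq_zero A).1 hA s v (fun d _ => hv d) h

/-- A graded vector space has a homogeneous basis. -/
theorem IsGrading.exists_basis {A : ℕ → Submodule K V} (hA : IsGrading A) :
    ∃ b : Module.Basis (Σ d, Fin (Module.finrank K (A d))) K V,
      ∀ d, A d = Submodule.span K (b '' {p | p.1 = d}) := by
  have hint : DirectSum.IsInternal A :=
    DirectSum.isInternal_submodule_of_iSupIndep_of_iSup_eq_top hA.indep hA.iSup_eq_top
  have := hA.fin
  refine ⟨hint.collectedBasis fun d => Module.finBasis K (A d), fun d => ?_⟩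
  rw [DirectSum.IsInternal.collectedBasis_coe]
  have h1 := congrArg (Submodule.map (A d).subtype) (Module.finBasis K (A d)).span_eq
  rw [Submodule.map_top, Submodule.range_subtype, Submodule.map_span] at h1
  refine h1.symm.trans (congrArg _ ?_)
  ext x
  constructor
  · rintro ⟨_, ⟨i, rfl⟩, rfl⟩
    exact ⟨⟨d, i⟩, rfl, rfl⟩
  · rintro ⟨⟨_, i⟩, rfl, rfl⟩
    exact ⟨_, ⟨i, rfl⟩, rfl⟩

/-- The spans of the fibres of a degree function on a basis form a grading. -/
theorem isGrading_of_basis {ι : Type*} (b : Module.Basis ι K V) (deg : ι → ℕ)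
    (hfin : ∀ d, {p | deg p = d}.Finite) {A : ℕ → Submodule K V}
    (hA : ∀ d, A d = Submodule.span K (b '' {p | deg p = d})) : IsGrading A where
  indep := by
    rw [iSupIndep_iff_finsetSum_eq_zero_imp_eq_zero]
    intro s v hv h d hd
    have hv' : ∀ e ∈ s, ∀ p, deg p ≠ e → b.repr (v e) p = 0 := by
      intro e he p hp
      by_contra h0
      have h1 := hv e he
      rw [hA, Module.Basis.mem_span_image] at h1
      exact hp (h1 (Finsupp.mem_support_iff.2 h0))
    apply b.repr.injective
    ext p
    by_cases hp : deg p = d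
    · have h2 := congrArg (fun x => b.repr x p) h
      simp only [map_sum, Finsupp.finsetSum_apply, map_zero, Finsupp.zero_apply] at h2
      rw [Finset.sum_eq_single d] at h2
      · simpa using h2
      · intro e he hne
        exact hv' e he p (hp.trans_ne hne.symm)
      · exact fun h => absurd hd h
    · simpa using hv' d hd p hp
  iSup_eq_top := by
    rw [eq_top_iff, ← b.span_eq, Submodule.span_le]
    rintro _ ⟨p, rfl⟩
    refine Submodule.mem_iSup_of_mem (deg p) ?_
    rw [hA]
    exact Submodule.subset_span ⟨p, rfl, rfl⟩
  fin d := by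
    rw [hA]
    exact FiniteDimensional.span_of_finite K ((hfin d).image _)

/-- The degree `j` piece of the tensor product of two graded vector spaces. -/
def tgr (A : ℕ → Submodule K V) (B : ℕ → Submodule K W) (j : ℕ) : Submodule K (V ⊗[K] W) :=
  Submodule.span K {t | ∃ a b : ℕ, a + b = j ∧ ∃ s ∈ A a, ∃ x ∈ B b, t = s ⊗ₜ[K] x}

theorem tmul_mem_tgr {A : ℕ → Submodule K V} {B : ℕ → Submodule K W} {a b j : ℕ}
    (h : a + b = j) {s : V} (hs : s ∈ A a) {x : W} (hx : x ∈ B b) : s ⊗ₜ[K] x ∈ tgr A B j :=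
  Submodule.subset_span ⟨a, b, h, s, hs, x, hx, rfl⟩

theorem tgr_le {A : ℕ → Submodule K V} {B : ℕ → Submodule K W} {j : ℕ}
    {U : Submodule K (V ⊗[K] W)}
    (h : ∀ a b, a + b = j → ∀ s ∈ A a, ∀ x ∈ B b, s ⊗ₜ[K] x ∈ U) : tgr A B j ≤ U := by
  refine Submodule.span_le.2 ?_
  rintro _ ⟨a, b, hab, s, hs, x, hx, rfl⟩
  exact h a b hab s hs x hx

theorem tgr_mono {A A' : ℕ → Submodule K V} {B B' : ℕ → Submodule K W} {j : ℕ}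
    (hA : ∀ d, A d ≤ A' d) (hB : ∀ d, B d ≤ B' d) : tgr A B j ≤ tgr A' B' j :=
  tgr_le fun _ _ h _ hs _ hx => tmul_mem_tgr h (hA _ hs) (hB _ hx)

theorem map_tgr (A : ℕ → Submodule K V) (B : ℕ → Submodule K W) (f : V →ₗ[K] V')
    (g : W →ₗ[K] W') (j : ℕ) :
    (tgr A B j).map (TensorProduct.map f g) =
      tgr (fun d => (A d).map f) (fun d => (B d).map g) j := by
  apply le_antisymm
  · rw [Submodule.map_le_iff_le_comap]
    refine tgr_le fun a b h s hs x hx => ?_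
    exact tmul_mem_tgr h (Submodule.mem_map_of_mem hs) (Submodule.mem_map_of_mem hx)
  · refine tgr_le ?_
    rintro a b h _ ⟨s, hs, rfl⟩ _ ⟨x, hx, rfl⟩
    exact ⟨_, tmul_mem_tgr h hs hx, TensorProduct.map_tmul _ _ _ _⟩

/-- With homogeneous bases the tensor grading becomes the partition of the product basis by total
degree, which reduces its independence and its dimensions to counting. -/
theorem tgr_eq_span_basis {ι κ : Type*} {b : Module.Basis ι K V} {c : Module.Basis κ K W}
    {deg : ι → ℕ} {deg' : κ → ℕ} {A : ℕ → Submodule K V} {B : ℕ → Submodule K W}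
    (hA : ∀ d, A d = Submodule.span K (b '' {p | deg p = d}))
    (hB : ∀ d, B d = Submodule.span K (c '' {p | deg' p = d})) (j : ℕ) :
    tgr A B j =
      Submodule.span K (b.tensorProduct c '' {p | deg p.1 + deg' p.2 = j}) := by
  apply le_antisymm
  · refine tgr_le fun a e h s hs x hx => ?_
    rw [hA] at hs
    rw [hB] at hx
    have key := Submodule.apply_mem_map₂ (TensorProduct.mk K V W) hs hx
    rw [Submodule.map₂_span_span] at key
    refine Submodule.span_mono ?_ key
    rintro _ ⟨_, ⟨p, hp, rfl⟩, _, ⟨q, hq, rfl⟩, rfl⟩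
    refine ⟨(p, q), ?_, Module.Basis.tensorProduct_apply _ _ _ _⟩
    change deg p + deg' q = j
    rw [show deg p = a from hp, show deg' q = e from hq, h]
  · rw [Submodule.span_le]
    rintro _ ⟨⟨p, q⟩, hpq, rfl⟩
    rw [Module.Basis.tensorProduct_apply]
    refine tmul_mem_tgr hpq ?_ ?_
    · rw [hA]; exact Submodule.subset_span ⟨p, rfl, rfl⟩
    · rw [hB]; exact Submodule.subset_span ⟨q, rfl, rfl⟩

theorem IsGrading.tgr {A : ℕ → Submodule K V} {B : ℕ → Submodule K W} (hA : IsGrading A)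
    (hB : IsGrading B) : IsGrading (tgr A B) := by
  obtain ⟨b, hb⟩ := hA.exists_basis
  obtain ⟨c, hc⟩ := hB.exists_basis
  refine isGrading_of_basis (b.tensorProduct c) (fun p => p.1.1 + p.2.1) ?_
    (tgr_eq_span_basis hb hc)
  intro d
  refine (((Finset.range (d + 1)).sigma fun i =>
    (Finset.univ : Finset (Fin (Module.finrank K (A i))))) ×ˢ
    (Finset.range (d + 1)).sigma fun i =>
    (Finset.univ : Finset (Fin (Module.finrank K (B i))))).finite_toSet.subset ?_
  rintro ⟨p, q⟩ (h : p.1 + q.1 = d)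
  simp only [Finset.mem_coe, Finset.mem_product, Finset.mem_sigma, Finset.mem_range,
    Finset.mem_univ, and_true]
  omega

theorem finrank_tgr {A : ℕ → Submodule K V} {B : ℕ → Submodule K W} (hA : IsGrading A)
    (hB : IsGrading B) (j : ℕ) :
    Module.finrank K (GenTor.tgr A B j) =
      ∑ p ∈ Finset.HasAntidiagonal.antidiagonal j,
        Module.finrank K (A p.1) * Module.finrank K (B p.2) := by
  obtain ⟨b, hb⟩ := hA.exists_basis
  obtain ⟨c, hc⟩ := hB.exists_basis
  let e : (Σ p : Finset.HasAntidiagonal.antidiagonal j,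
      Fin (Module.finrank K (A p.1.1)) × Fin (Module.finrank K (B p.1.2))) →
      (Σ d, Fin (Module.finrank K (A d))) × (Σ d, Fin (Module.finrank K (B d))) :=
    fun x => (⟨x.1.1.1, x.2.1⟩, ⟨x.1.1.2, x.2.2⟩)
  have he : Function.Injective e := by
    rintro ⟨⟨⟨p, p'⟩, hp⟩, i, i'⟩ ⟨⟨⟨q, q'⟩, hq⟩, k, k'⟩ h
    simp only [e, Prod.mk.injEq, Sigma.mk.injEq] at h
    obtain ⟨⟨rfl, h1⟩, rfl, h2⟩ := h
    rw [heq_eq_eq] at h1 h2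
    subst h1 h2
    rfl
  have hr : Set.range e = {p | p.1.1 + p.2.1 = j} := by
    ext ⟨⟨p, i⟩, ⟨q, k⟩⟩
    constructor
    · rintro ⟨⟨⟨⟨p, p'⟩, hp⟩, i, i'⟩, h⟩
      rw [← h]
      exact Finset.HasAntidiagonal.mem_antidiagonal.1 hp
    · intro h
      exact ⟨⟨⟨(p, q), Finset.HasAntidiagonal.mem_antidiagonal.2 h⟩, i, k⟩, rfl⟩
  rw [tgr_eq_span_basis hb hc, ← hr, ← Set.range_comp,
    finrank_span_eq_card ((b.tensorProduct c).linearIndependent.comp e he), Fintype.card_sigma]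
  simp only [Fintype.card_prod, Fintype.card_fin]
  exact Finset.sum_coe_sort (Finset.HasAntidiagonal.antidiagonal j)
    fun p => Module.finrank K (A p.1) * Module.finrank K (B p.2)

/-- A linear map that is surjective in each degree has a graded section. -/
theorem IsGrading.exists_section {A : ℕ → Submodule K V} {B : ℕ → Submodule K W}
    (hB : IsGrading B) {f : V →ₗ[K] W} (hf : ∀ d, (A d).map f = B d) :
    ∃ σ : W →ₗ[K] V, (∀ d, ∀ x ∈ B d, σ x ∈ A d) ∧ ∀ x, f (σ x) = x := by
  obtain ⟨b, hb⟩ := hB.exists_basis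
  have h : ∀ p, ∃ y ∈ A p.1, f y = b p := by
    intro p
    have : b p ∈ B p.1 := by rw [hb]; exact Submodule.subset_span ⟨p, rfl, rfl⟩
    rw [← hf] at this
    exact this
  choose y hy hfy using h
  refine ⟨b.constr K y, fun d x hx => ?_, fun x => ?_⟩
  · rw [hb] at hx
    have : Submodule.span K (b '' {p | p.1 = d}) ≤ (A d).comap (b.constr K y) := by
      rw [Submodule.span_le]
      rintro _ ⟨p, rfl, rfl⟩
      simpa using hy p
    exact this hx
  · have : f ∘ₗ b.constr K y = LinearMap.id := b.ext fun p => by simp [hfy]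
    exact LinearMap.congr_fun this x

/-- The kernel of a tensor product of two graded surjections. -/
theorem tgr_inf_ker {A : ℕ → Submodule K V} {B : ℕ → Submodule K W} {A' : ℕ → Submodule K V'}
    {B' : ℕ → Submodule K W'} (hA' : IsGrading A') (hB' : IsGrading B') {f : V →ₗ[K] V'}
    {g : W →ₗ[K] W'} (hf : ∀ d, (A d).map f = A' d) (hg : ∀ d, (B d).map g = B' d) (j : ℕ) :
    tgr A B j ⊓ LinearMap.ker (TensorProduct.map f g) =
      tgr (fun d => A d ⊓ LinearMap.ker f) B j ⊔ tgr A (fun d => B d ⊓ LinearMap.ker g) j := by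
  apply le_antisymm
  · obtain ⟨σ, hσ, hfσ⟩ := hA'.exists_section hf
    obtain ⟨τ, hτ, hgτ⟩ := hB'.exists_section hg
    rintro w ⟨hw, hw0⟩
    -- With graded sections `σ`, `τ`, the operator `id - (σ ∘ f) ⊗ (τ ∘ g)` sends pure tensors into
    -- the right-hand side. It fixes every element killed by `f ⊗ g`, in particular `w`.
    have key : tgr A B j ≤ (tgr (fun d => A d ⊓ LinearMap.ker f) B j ⊔
        tgr A (fun d => B d ⊓ LinearMap.ker g) j).comap
        (LinearMap.id - TensorProduct.map σ τ ∘ₗ TensorProduct.map f g) := by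
      refine tgr_le fun a b h s hs x hx => ?_
      have hs' : σ (f s) ∈ A a := hσ _ _ (hf a ▸ Submodule.mem_map_of_mem hs)
      have hx' : τ (g x) ∈ B b := hτ _ _ (hg b ▸ Submodule.mem_map_of_mem hx)
      have e : ((LinearMap.id : V ⊗[K] W →ₗ[K] V ⊗[K] W) -
            TensorProduct.map σ τ ∘ₗ TensorProduct.map f g) (s ⊗ₜ[K] x) =
          (s - σ (f s)) ⊗ₜ[K] x + σ (f s) ⊗ₜ[K] (x - τ (g x)) := by
        simp only [LinearMap.sub_apply, LinearMap.id_apply, LinearMap.comp_apply,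
          TensorProduct.map_tmul, TensorProduct.sub_tmul, TensorProduct.tmul_sub]
        abel
      rw [Submodule.mem_comap, e]
      have hs0 : s - σ (f s) ∈ A a ⊓ LinearMap.ker f :=
        ⟨Submodule.sub_mem _ hs hs', by simp [hfσ]⟩
      have hx0 : x - τ (g x) ∈ B b ⊓ LinearMap.ker g :=
        ⟨Submodule.sub_mem _ hx hx', by simp [hgτ]⟩
      exact Submodule.add_mem_sup (tmul_mem_tgr h hs0 hx) (tmul_mem_tgr h hs' hx0)
    have := key hw
    simpa [LinearMap.mem_ker.1 hw0] using this
  · refine sup_le (le_inf (tgr_mono (fun _ => inf_le_left) fun _ => le_rfl) ?_)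
      (le_inf (tgr_mono (fun _ => le_rfl) fun _ => inf_le_left) ?_)
    · refine tgr_le fun a b h s hs x hx => ?_
      rw [LinearMap.mem_ker, TensorProduct.map_tmul, LinearMap.mem_ker.1 hs.2,
        TensorProduct.zero_tmul]
    · refine tgr_le fun a b h s hs x hx => ?_
      rw [LinearMap.mem_ker, TensorProduct.map_tmul, LinearMap.mem_ker.1 hx.2,
        TensorProduct.tmul_zero]

/-- The grading induced on the source of an injective linear map. -/
theorem IsGrading.comap {A : ℕ → Submodule K V} (hA : IsGrading A) {f : W →ₗ[K] V}
    (hf : Function.Injective f) (hsup : ⨆ d, (A d).comap f = ⊤) :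
    IsGrading fun d => (A d).comap f where
  indep := by
    rw [iSupIndep_iff_finsetSum_eq_zero_imp_eq_zero]
    intro s v hv h d hd
    apply hf
    rw [map_zero]
    refine (iSupIndep_iff_finsetSum_eq_zero_imp_eq_zero A).1 hA.indep s
      (fun d => f (v d)) hv ?_ d hd
    rw [← map_sum, h, map_zero]
  iSup_eq_top := hsup
  fin d := by
    have := hA.fin d
    exact FiniteDimensional.of_injective (f.restrict fun x (hx : x ∈ (A d).comap f) => hx)
      fun x y h => Subtype.ext (hf (congrArg Subtype.val h))

end Graded

end GenTor

/-! ### Gradings and Hilbert functions of quotients, ideals and syzygy modules -/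

namespace GenTor

section Graded

variable {K : Type*} [Field K] {V W : Type*} [AddCommGroup V] [Module K V]
  [AddCommGroup W] [Module K W]

/-- The homogeneous elements in the range of a graded map are images of homogeneous elements. -/
theorem inf_range_eq_map {A : ℕ → Submodule K V} {B : ℕ → Submodule K W} (hA : iSup A = ⊤)
    (hB : iSupIndep B) {f : V →ₗ[K] W} (hf : ∀ d, (A d).map f ≤ B d) (j : ℕ) :
    B j ⊓ LinearMap.range f = (A j).map f := by
  apply le_antisymm
  · rintro _ ⟨hj, x, rfl⟩
    obtain ⟨s, v, hv, rfl⟩ := IsGrading.exists_sum hA x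
    rw [map_sum] at hj ⊢
    rw [IsGrading.sum_eq hB (fun d => hf d (Submodule.mem_map_of_mem (hv d))) hj]
    split_ifs
    · exact Submodule.mem_map_of_mem (hv j)
    · exact Submodule.zero_mem _
  · exact le_inf (hf j) (LinearMap.map_le_range)

end Graded

variable {K : Type u} [Field K] {n : ℕ}

/-- The graded pieces form a grading by finite-dimensional spaces that is compatible with the
module structure. -/
structure GrMod.IsGraded (M : GrMod K n) : Prop where
  grading : IsGrading M.gr
  smul_mem : ∀ {a b : ℕ} {s : MvPolynomial (Fin n) K} {x : M.carrier},
    s ∈ MvPolynomial.homogeneousSubmodule (Fin n) K a → x ∈ M.gr b → s • x ∈ M.gr (a + b)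

/-- The polynomial ring as a graded module over itself. -/
def polyMod (K : Type u) [Field K] (n : ℕ) : GrMod K n where
  carrier := MvPolynomial (Fin n) K
  gr := MvPolynomial.homogeneousSubmodule (Fin n) K

theorem homogeneousSubmodule_eq_span (d : ℕ) :
    MvPolynomial.homogeneousSubmodule (Fin n) K d =
      Submodule.span K (MvPolynomial.basisMonomials (Fin n) K '' {a | a.degree = d}) := by
  ext p
  rw [Module.Basis.mem_span_image, MvPolynomial.mem_homogeneousSubmodule]
  constructor
  · intro h a ha
    by_contra hne
    exact Finsupp.mem_support_iff.1 ha (h.coeff_eq_zero hne)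
  · intro h a ha
    exact (DFunLike.congr_fun Finsupp.degree_eq_weight_one.symm a).trans
      (h (Finsupp.mem_support_iff.2 ha))

theorem isGrading_homogeneousSubmodule :
    IsGrading (MvPolynomial.homogeneousSubmodule (Fin n) K) :=
  isGrading_of_basis (MvPolynomial.basisMonomials (Fin n) K) Finsupp.degree
    (fun d => (Finsupp.finite_of_degree_le d).subset fun _ h => le_of_eq h)
    homogeneousSubmodule_eq_span

theorem polyMod_isGraded : (polyMod K n).IsGraded where
  grading := isGrading_homogeneousSubmodule
  smul_mem hs hx := MvPolynomial.IsHomogeneous.mul hs hx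

section

attribute [local instance] MvPolynomial.gradedAlgebra

theorem IsHomog.component_mem {I : Ideal (MvPolynomial (Fin n) K)} (hI : IsHomog I)
    {f : MvPolynomial (Fin n) K} (hf : f ∈ I) (d : ℕ) :
    MvPolynomial.homogeneousComponent d f ∈ I :=
  MvPolynomial.homogeneousComponent_mem_of_mem hI hf d

theorem isHomog_of_component_mem {I : Ideal (MvPolynomial (Fin n) K)}
    (h : ∀ f ∈ I, ∀ d, MvPolynomial.homogeneousComponent d f ∈ I) : IsHomog I := by
  intro d f hf
  have := h f hf d
  rwa [← MvPolynomial.decomposition.decompose'_apply] at this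

end

/-- Independence is where homogeneity of `I` enters: a relation among classes lifts to a sum lying
in `I`, and then each homogeneous component of that sum lies in `I`. -/
theorem quotMod_isGraded {I : Ideal (MvPolynomial (Fin n) K)} (hI : IsHomog I) :
    (quotMod I).IsGraded where
  grading :=
    { indep := by
        rw [iSupIndep_iff_finsetSum_eq_zero_imp_eq_zero]
        intro s v hv h
        have h1 : ∀ d, ∃ f ∈ MvPolynomial.homogeneousSubmodule (Fin n) K d,
            d ∈ s → Ideal.Quotient.mk I f = v d := by
          intro d
          by_cases hd : d ∈ s
          · obtain ⟨f, hf, hfv⟩ := hv d hd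
            exact ⟨f, hf, fun _ => hfv⟩
          · exact ⟨0, Submodule.zero_mem _, fun h => absurd h hd⟩
        choose f hf hfv using h1
        have h2 : ∑ d ∈ s, f d ∈ I := by
          rw [← Ideal.Quotient.eq_zero_iff_mem, map_sum]
          exact (Finset.sum_congr rfl hfv).trans h
        intro d hd
        have h3 := IsHomog.component_mem hI h2 d
        rw [map_sum, Finset.sum_eq_single d] at h3
        · rw [← hfv d hd]
          rw [MvPolynomial.homogeneousComponent_of_mem (hf d), if_pos rfl] at h3
          exact Ideal.Quotient.eq_zero_iff_mem.2 h3
        · intro e _ hne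
          rw [MvPolynomial.homogeneousComponent_of_mem (hf e), if_neg hne.symm]
        · exact fun h => absurd hd h
      iSup_eq_top := by
        change ⨆ d, Submodule.map _ _ = _
        rw [← Submodule.map_iSup, isGrading_homogeneousSubmodule.iSup_eq_top, Submodule.map_top]
        exact LinearMap.range_eq_top.2 Ideal.Quotient.mk_surjective
      fin := fun d => by
        have := (isGrading_homogeneousSubmodule (K := K) (n := n)).fin d
        exact inferInstanceAs (FiniteDimensional K ((MvPolynomial.homogeneousSubmodule
          (Fin n) K d).map (Ideal.Quotient.mkₐ K I).toLinearMap)) }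
  smul_mem := by
    rintro a b s _ hs ⟨x, hx, rfl⟩
    exact ⟨s * x, MvPolynomial.IsHomogeneous.mul hs hx, rfl⟩

theorem idealMod_isGraded {I : Ideal (MvPolynomial (Fin n) K)} (hI : IsHomog I) :
    (idealMod I).IsGraded where
  grading := by
    refine isGrading_homogeneousSubmodule.comap (f := I.subtype.restrictScalars K)
      I.subtype_injective ?_
    rw [eq_top_iff]
    rintro ⟨f, hf⟩ -
    have h : (⟨f, hf⟩ : I) = ∑ d ∈ Finset.range (f.totalDegree + 1),
        ⟨MvPolynomial.homogeneousComponent d f, IsHomog.component_mem hI hf d⟩ := by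
      apply Subtype.ext
      rw [AddSubmonoidClass.coe_finsetSum]
      exact (MvPolynomial.sum_homogeneousComponent f).symm
    rw [h]
    refine Submodule.sum_mem _ fun d _ => Submodule.mem_iSup_of_mem d ?_
    exact MvPolynomial.homogeneousComponent_isHomogeneous d f
  smul_mem hs hx := MvPolynomial.IsHomogeneous.mul hs hx

theorem GrMod.IsGraded.freeOn {M : GrMod K n} (hM : M.IsGraded) : (freeOn M).IsGraded where
  grading := isGrading_homogeneousSubmodule.tgr hM.grading
  smul_mem := by
    intro a b s x hs hx
    have key : (GenTor.freeOn M).gr b ≤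
        ((GenTor.freeOn M).gr (a + b)).comap
          ((LinearMap.lsmul _ (GenTor.freeOn M).carrier s).restrictScalars K) := by
      refine tgr_le fun c d hcd t ht y hy => ?_
      exact tmul_mem_tgr (s := s * t) (by omega) (MvPolynomial.IsHomogeneous.mul hs ht) hy
    exact key hx

theorem cover_mem {M : GrMod K n} (hM : M.IsGraded) {d : ℕ} {z : (freeOn M).carrier}
    (hz : z ∈ (freeOn M).gr d) : cover M z ∈ M.gr d := by
  have key : (freeOn M).gr d ≤ (M.gr d).comap ((cover M).restrictScalars K) := by
    refine tgr_le fun a b h s hs x hx => ?_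
    subst h
    exact hM.smul_mem hs hx
  exact key hz

theorem one_mem_homogeneousSubmodule :
    (1 : MvPolynomial (Fin n) K) ∈ MvPolynomial.homogeneousSubmodule (Fin n) K 0 :=
  MvPolynomial.isHomogeneous_one _ _

/-- The map `x ↦ 1 ⊗ x`. -/
def unitTmul (M : GrMod K n) : M.carrier →ₗ[K] (freeOn M).carrier :=
  TensorProduct.mk K (MvPolynomial (Fin n) K) M.carrier 1

theorem cover_unitTmul (M : GrMod K n) (x : M.carrier) : cover M (unitTmul M x) = x :=
  one_smul _ x

theorem unitTmul_mem {M : GrMod K n} {d : ℕ} {x : M.carrier} (hx : x ∈ M.gr d) :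
    unitTmul M x ∈ (freeOn M).gr d :=
  tmul_mem_tgr (zero_add d) one_mem_homogeneousSubmodule hx

/-- The retraction `s ⊗ x ↦ s ⊗ x - 1 ⊗ s x` of `S ⊗ M` onto the first syzygy module. -/
def toSyz (M : GrMod K n) : (freeOn M).carrier →ₗ[K] (syz M).carrier :=
  LinearMap.codRestrict ((LinearMap.ker (cover M)).restrictScalars K)
    (LinearMap.id - unitTmul M ∘ₗ (cover M).restrictScalars K) fun z => by
      change cover M (z - unitTmul M (cover M z)) = 0
      rw [map_sub, cover_unitTmul, sub_self]

theorem syzIncl_toSyz (M : GrMod K n) (z : (freeOn M).carrier) :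
    syzIncl M (toSyz M z) = z - unitTmul M (cover M z) :=
  rfl

theorem cover_syzIncl (M : GrMod K n) (z : (syz M).carrier) : cover M (syzIncl M z) = 0 :=
  z.2

/-- This presents syzygies as the image of a fixed linear map and not only as a kernel. Polynomial
sections can be pushed forward along linear maps, whereas kernels give no such control. -/
theorem toSyz_syzIncl (M : GrMod K n) (z : (syz M).carrier) : toSyz M (syzIncl M z) = z := by
  apply syzIncl_injective
  rw [syzIncl_toSyz, cover_syzIncl, map_zero, sub_zero]

theorem mem_syz_gr {M : GrMod K n} {d : ℕ} {z : (syz M).carrier} :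
    z ∈ (syz M).gr d ↔ syzIncl M z ∈ (freeOn M).gr d :=
  Iff.rfl

theorem toSyz_mem {M : GrMod K n} (hM : M.IsGraded) {d : ℕ} {z : (freeOn M).carrier}
    (hz : z ∈ (freeOn M).gr d) : toSyz M z ∈ (syz M).gr d := by
  rw [mem_syz_gr, syzIncl_toSyz]
  exact Submodule.sub_mem _ hz (unitTmul_mem (cover_mem hM hz))

theorem GrMod.IsGraded.syz {M : GrMod K n} (hM : M.IsGraded) : (syz M).IsGraded where
  grading := by
    refine hM.freeOn.grading.comap (f := (syzIncl M).restrictScalars K)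
      (syzIncl_injective M) ?_
    rw [eq_top_iff]
    rintro z -
    obtain ⟨s, v, hv, h⟩ := IsGrading.exists_sum hM.freeOn.grading.iSup_eq_top (syzIncl M z)
    rw [← toSyz_syzIncl M z, h, map_sum]
    exact Submodule.sum_mem _ fun d _ => Submodule.mem_iSup_of_mem d (toSyz_mem hM (hv d))
  smul_mem hs hx := hM.freeOn.smul_mem hs hx

theorem GrMod.IsGraded.syzIter {M : GrMod K n} (hM : M.IsGraded) (i : ℕ) :
    (syzIter M i).IsGraded := by
  induction i with
  | zero => exact hM
  | succ i ih => exact ih.syz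

/-- The Hilbert function. -/
def GrMod.hf (M : GrMod K n) (d : ℕ) : ℕ := Module.finrank K (M.gr d)

theorem hf_freeOn {M : GrMod K n} (hM : M.IsGraded) (d : ℕ) :
    (freeOn M).hf d =
      ∑ p ∈ Finset.HasAntidiagonal.antidiagonal d, (polyMod K n).hf p.1 * M.hf p.2 :=
  finrank_tgr isGrading_homogeneousSubmodule hM.grading d

/-- Rank-nullity for the cover in degree `d`, which is onto because `x ↦ 1 ⊗ x` preserves degree. -/
theorem hf_syz {M : GrMod K n} (hM : M.IsGraded) (d : ℕ) :
    M.hf d + (syz M).hf d = (freeOn M).hf d := by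
  have := hM.freeOn.grading.fin d
  have h := finrank_map_add_finrank_inf_ker ((cover M).restrictScalars K) ((freeOn M).gr d)
  have h1 : ((freeOn M).gr d).map ((cover M).restrictScalars K) = M.gr d := by
    apply le_antisymm
    · rintro _ ⟨z, hz, rfl⟩
      exact cover_mem hM hz
    · intro x hx
      exact ⟨unitTmul M x, unitTmul_mem hx, cover_unitTmul M x⟩
  have h2 : ((syz M).gr d).map ((syzIncl M).restrictScalars K) =
      (freeOn M).gr d ⊓ LinearMap.ker ((cover M).restrictScalars K) := by
    ext z
    constructor
    · rintro ⟨w, hw, rfl⟩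
      exact ⟨hw, cover_syzIncl M w⟩
    · rintro ⟨hz, hz'⟩
      exact ⟨⟨z, hz'⟩, hz, rfl⟩
  rw [h1, ← h2] at h
  rw [GrMod.hf, GrMod.hf, GrMod.hf, ← h,
    (Submodule.equivMapOfInjective ((syzIncl M).restrictScalars K)
      (syzIncl_injective M) ((syz M).gr d)).finrank_eq]

/-- `S` has no negative degrees, so the cover in degree `d` sees `M` only in degrees at most `d`. A
bound on the degree therefore survives the recursion through `hf_syz`. -/
theorem hf_syzIter_congr {M M' : GrMod K n} (hM : M.IsGraded) (hM' : M'.IsGraded) {j : ℕ}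
    (h : ∀ d ≤ j, M.hf d = M'.hf d) (i : ℕ) :
    ∀ d ≤ j, (syzIter M i).hf d = (syzIter M' i).hf d := by
  induction i with
  | zero => exact h
  | succ i ih =>
    intro d hd
    have h1 := hf_syz (hM.syzIter i) d
    have h2 := hf_syz (hM'.syzIter i) d
    have h3 : (freeOn (syzIter M i)).hf d = (freeOn (syzIter M' i)).hf d := by
      rw [hf_freeOn (hM.syzIter i), hf_freeOn (hM'.syzIter i)]
      refine Finset.sum_congr rfl fun p hp => ?_
      rw [ih p.2 ((Finset.HasAntidiagonal.antidiagonal.snd_le hp).trans hd)]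
    have h4 := ih d hd
    change (syz (syzIter M i)).hf d = (syz (syzIter M' i)).hf d
    omega

/-- The degree `j` piece of `syz^i(M) ⊗_K N`. -/
abbrev syzTgr (M N : GrMod K n) (i j : ℕ) :
    Submodule K ((syzIter M i).carrier ⊗[K] N.carrier) :=
  tgr (syzIter M i).gr N.gr j

theorem finrank_syzTgr_congr {M M' N N' : GrMod K n} (hM : M.IsGraded) (hM' : M'.IsGraded)
    (hN : N.IsGraded) (hN' : N'.IsGraded) {j : ℕ} (h : ∀ d ≤ j, M.hf d = M'.hf d)
    (h' : ∀ d ≤ j, N.hf d = N'.hf d) (i : ℕ) :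
    Module.finrank K (syzTgr M N i j) = Module.finrank K (syzTgr M' N' i j) := by
  rw [finrank_tgr (hM.syzIter i).grading hN.grading,
    finrank_tgr (hM'.syzIter i).grading hN'.grading]
  refine Finset.sum_congr rfl fun p hp => ?_
  have h1 := hf_syzIter_congr hM hM' h i p.1 (Finset.HasAntidiagonal.antidiagonal.fst_le hp)
  have h2 := h' p.2 (Finset.HasAntidiagonal.antidiagonal.snd_le hp)
  rw [GrMod.hf, GrMod.hf] at h1 h2
  rw [h1, h2]

theorem hf_polyMod_zero : (polyMod K n).hf 0 = 1 := by
  change Module.finrank K (MvPolynomial.homogeneousSubmodule (Fin n) K 0) = 1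
  rw [MvPolynomial.homogeneousSubmodule_zero, Submodule.one_eq_span]
  exact finrank_span_singleton one_ne_zero

/-- The `i`-th syzygies have no elements of degree less than `i`. -/
theorem hf_syzIter_eq_zero {M : GrMod K n} (hM : M.IsGraded) (i : ℕ) :
    ∀ d < i, (syzIter M i).hf d = 0 := by
  induction i with
  | zero => intro d hd; omega
  | succ i ih =>
    intro d hd
    have h1 := hf_syz (hM.syzIter i) d
    -- By induction the cover in degree `d ≤ i` reduces to `S_0 ⊗ (syz^i)_d`, which has the
    -- dimension of its image, so its kernel is zero.
    have h2 : (freeOn (syzIter M i)).hf d = (syzIter M i).hf d := by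
      rw [hf_freeOn (hM.syzIter i), Finset.sum_eq_single (0, d)]
      · rw [hf_polyMod_zero, one_mul]
      · rintro ⟨p, q⟩ hp hne
        have h3 : p + q = d := Finset.HasAntidiagonal.mem_antidiagonal.1 hp
        have h4 : p ≠ 0 := by
          rintro rfl
          rw [zero_add] at h3
          exact hne (by rw [h3])
        rw [ih q (by omega), mul_zero]
      · intro h
        exact absurd (Finset.HasAntidiagonal.mem_antidiagonal.2 (zero_add d)) h
    change (syz (syzIter M i)).hf d = 0
    omega

theorem finrank_syzTgr_eq_zero {M N : GrMod K n} (hM : M.IsGraded) (hN : N.IsGraded) {i j : ℕ}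
    (h : j < i) : Module.finrank K (syzTgr M N i j) = 0 := by
  rw [finrank_tgr (hM.syzIter i).grading hN.grading]
  refine Finset.sum_eq_zero fun p hp => ?_
  have h1 := hf_syzIter_eq_zero hM i p.1
    ((Finset.HasAntidiagonal.antidiagonal.fst_le hp).trans_lt h)
  rw [GrMod.hf] at h1
  rw [h1, zero_mul]

end GenTor

/-! ### The Tor complex over the base field, and Tor in terms of ranks -/

namespace GenTor

variable {K : Type u} [Field K] {n : ℕ}

/-- The identification `(S ⊗_K X) ⊗_S N = X ⊗_K N`. -/
def freeTensorEquiv (X N : GrMod K n) :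
    (freeOn X).carrier ⊗[MvPolynomial (Fin n) K] N.carrier ≃ₗ[K] X.carrier ⊗[K] N.carrier :=
  ((TensorProduct.comm (MvPolynomial (Fin n) K)
      (MvPolynomial (Fin n) K ⊗[K] X.carrier) N.carrier).restrictScalars K) ≪≫ₗ
    ((TensorProduct.AlgebraTensorModule.cancelBaseChange K (MvPolynomial (Fin n) K)
      (MvPolynomial (Fin n) K) N.carrier X.carrier).restrictScalars K) ≪≫ₗ
    TensorProduct.comm K N.carrier X.carrier

/-- The action of `S ⊗ X` on `N` with values in `X ⊗ N`: `s ⊗ x` sends `y` to `x ⊗ s y`. -/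
def freeAct (X N : GrMod K n) :
    (freeOn X).carrier →ₗ[K] N.carrier →ₗ[K] X.carrier ⊗[K] N.carrier :=
  TensorProduct.lift
    (LinearMap.mk₂ K (fun (s : MvPolynomial (Fin n) K) (x : X.carrier) =>
        (TensorProduct.mk K X.carrier N.carrier x) ∘ₗ
          ((LinearMap.lsmul (MvPolynomial (Fin n) K) N.carrier s).restrictScalars K))
      (fun s t x => by ext y; simp [TensorProduct.tmul_add])
      (fun c s x => by ext y; simp)
      (fun s x y => by ext z; simp)
      (fun c s x => by ext y; simp [TensorProduct.smul_tmul']))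

/-- The pure tensors of `S ⊗ X`. -/
def freeTmul (X : GrMod K n) :
    MvPolynomial (Fin n) K →ₗ[K] X.carrier →ₗ[K] (freeOn X).carrier :=
  TensorProduct.mk K (MvPolynomial (Fin n) K) X.carrier

theorem freeOn_induction {X : GrMod K n} {p : (freeOn X).carrier → Prop}
    (h0 : p 0) (ht : ∀ (s : MvPolynomial (Fin n) K) (x : X.carrier), p (freeTmul X s x))
    (ha : ∀ z w, p z → p w → p (z + w)) (z : (freeOn X).carrier) : p z :=
  TensorProduct.induction_on (R := K) z h0 ht ha

theorem freeOn_gr_le {X : GrMod K n} {d : ℕ} {U : Submodule K (freeOn X).carrier}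
    (h : ∀ a b, a + b = d → ∀ s ∈ MvPolynomial.homogeneousSubmodule (Fin n) K a, ∀ x ∈ X.gr b,
      freeTmul X s x ∈ U) : (freeOn X).gr d ≤ U :=
  tgr_le h

theorem cover_freeTmul (X : GrMod K n) (s : MvPolynomial (Fin n) K) (x : X.carrier) :
    cover X (freeTmul X s x) = s • x :=
  rfl

theorem smul_freeTmul (X : GrMod K n) (s t : MvPolynomial (Fin n) K) (x : X.carrier) :
    s • freeTmul X t x = freeTmul X (s * t) x :=
  rfl

theorem unitTmul_eq (X : GrMod K n) (x : X.carrier) : unitTmul X x = freeTmul X 1 x :=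
  rfl

theorem freeAct_freeTmul (X N : GrMod K n) (s : MvPolynomial (Fin n) K) (x : X.carrier)
    (y : N.carrier) : freeAct X N (freeTmul X s x) y = x ⊗ₜ[K] (s • y) :=
  rfl

theorem freeTensorEquiv_tmul (X N : GrMod K n) (z : (freeOn X).carrier) (y : N.carrier) :
    freeTensorEquiv X N (z ⊗ₜ[MvPolynomial (Fin n) K] y) = freeAct X N z y := by
  induction z using freeOn_induction with
  | h0 => rw [TensorProduct.zero_tmul, map_zero, map_zero, LinearMap.zero_apply]
  | ht s x => rfl
  | ha z w hz hw => rw [TensorProduct.add_tmul, map_add, map_add, LinearMap.add_apply, hz, hw]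

/-- `freeAct` is balanced over `S` because it factors through the tensor product over `S`. -/
theorem freeAct_smul (X N : GrMod K n) (s : MvPolynomial (Fin n) K) (z : (freeOn X).carrier)
    (y : N.carrier) : freeAct X N (s • z) y = freeAct X N z (s • y) := by
  rw [← freeTensorEquiv_tmul, ← freeTensorEquiv_tmul, TensorProduct.smul_tmul]

/-- The map `syz(X) ⊗_K N → X ⊗_K N` that describes the differential of the Tor complex. -/
def syzD (X N : GrMod K n) :
    (syz X).carrier ⊗[K] N.carrier →ₗ[K] X.carrier ⊗[K] N.carrier :=
  TensorProduct.lift (freeAct X N ∘ₗ (syzIncl X).restrictScalars K)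

theorem syzD_tmul (X N : GrMod K n) (z : (syz X).carrier) (y : N.carrier) :
    syzD X N (z ⊗ₜ[K] y) = freeAct X N (syzIncl X z) y :=
  rfl

/-- The differential `syz^{i+1}(M) ⊗_K N → syz^i(M) ⊗_K N`. -/
def syzIterD (M N : GrMod K n) (i : ℕ) :
    (syzIter M (i + 1)).carrier ⊗[K] N.carrier →ₗ[K] (syzIter M i).carrier ⊗[K] N.carrier :=
  syzD (syzIter M i) N

/-- Identifies `syzD` with the differential of the Tor complex, so that ranks can be computed on
tensor products over `K`. -/
theorem syzD_freeTensorEquiv (X N : GrMod K n)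
    (t : (freeOn (syz X)).carrier ⊗[MvPolynomial (Fin n) K] N.carrier) :
    syzD X N (freeTensorEquiv (syz X) N t) =
      freeTensorEquiv X N ((syzIncl X ∘ₗ cover (syz X)).rTensor N.carrier t) := by
  induction t using TensorProduct.induction_on with
  | zero => simp only [map_zero]
  | add t t' h h' => simp only [map_add, h, h']
  | tmul z y =>
    rw [LinearMap.rTensor_tmul, freeTensorEquiv_tmul, freeTensorEquiv_tmul]
    induction z using freeOn_induction with
    | h0 => simp only [map_zero, LinearMap.zero_apply]
    | ha z w hz hw => simp only [map_add, LinearMap.add_apply, hz, hw]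
    | ht s x =>
      rw [freeAct_freeTmul, syzD_tmul, LinearMap.comp_apply, cover_freeTmul,
        map_smul (syzIncl X), freeAct_smul]

theorem syzIterD_freeTensorEquiv (M N : GrMod K n) (i : ℕ) (t : torTerm M N (i + 1)) :
    syzIterD M N i (freeTensorEquiv (syzIter M (i + 1)) N t) =
      freeTensorEquiv (syzIter M i) N (torD M N i t) :=
  syzD_freeTensorEquiv (syzIter M i) N t

theorem freeAct_mem {X N : GrMod K n} (hN : N.IsGraded) {a b j : ℕ} (h : a + b = j)
    {z : (freeOn X).carrier} (hz : z ∈ (freeOn X).gr a) {y : N.carrier} (hy : y ∈ N.gr b) :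
    freeAct X N z y ∈ tgr X.gr N.gr j := by
  have key : (freeOn X).gr a ≤ (tgr X.gr N.gr j).comap ((freeAct X N).flip y) := by
    refine freeOn_gr_le fun c d hcd s hs x hx => ?_
    rw [Submodule.mem_comap, LinearMap.flip_apply, freeAct_freeTmul]
    exact tmul_mem_tgr (by omega) hx (hN.smul_mem hs hy)
  exact key hz

theorem map_syzD_le {X N : GrMod K n} (hN : N.IsGraded) (j : ℕ) :
    (tgr (syz X).gr N.gr j).map (syzD X N) ≤ tgr X.gr N.gr j := by
  rw [Submodule.map_le_iff_le_comap]
  refine tgr_le fun a b h z hz y hy => ?_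
  rw [Submodule.mem_comap, syzD_tmul]
  exact freeAct_mem hN h hz hy

theorem map_syzIterD_le {M N : GrMod K n} (hN : N.IsGraded) (i j : ℕ) :
    (syzTgr M N (i + 1) j).map (syzIterD M N i) ≤ syzTgr M N i j :=
  map_syzD_le hN j

theorem map_freeTensorEquiv {M N : GrMod K n} (hN : N.IsGraded) (i j : ℕ) :
    (torTermGr M N i j).map (freeTensorEquiv (syzIter M i) N).toLinearMap = syzTgr M N i j := by
  apply le_antisymm
  · rw [Submodule.map_le_iff_le_comap]
    refine Submodule.span_le.2 ?_
    rintro _ ⟨a, b, h, z, hz, y, hy, rfl⟩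
    change freeTensorEquiv (syzIter M i) N (z ⊗ₜ y) ∈ syzTgr M N i j
    rw [freeTensorEquiv_tmul]
    exact freeAct_mem hN h hz hy
  · refine tgr_le fun a b h x hx y hy => ?_
    refine ⟨unitTmul _ x ⊗ₜ[MvPolynomial (Fin n) K] y,
      Submodule.subset_span ⟨a, b, h, _, unitTmul_mem hx, y, hy, rfl⟩, ?_⟩
    change freeTensorEquiv _ N _ = _
    rw [freeTensorEquiv_tmul, unitTmul_eq, freeAct_freeTmul, one_smul]

/-- The rank of the degree `j` piece of the differential `F_{i+1} ⊗ N → F_i ⊗ N`. -/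
def torRank (M N : GrMod K n) (i j : ℕ) : ℕ :=
  Module.finrank K ((syzTgr M N (i + 1) j).map (syzIterD M N i))

theorem finrank_map_torD {M N : GrMod K n} (hN : N.IsGraded) (i j : ℕ) :
    Module.finrank K ((torTermGr M N (i + 1) j).map ((torD M N i).restrictScalars K)) =
      torRank M N i j := by
  rw [torRank, ← map_freeTensorEquiv hN, ← Submodule.map_comp]
  have h : syzIterD M N i ∘ₗ (freeTensorEquiv (syzIter M (i + 1)) N).toLinearMap =
      (freeTensorEquiv (syzIter M i) N).toLinearMap ∘ₗ (torD M N i).restrictScalars K :=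
    LinearMap.ext fun t => syzIterD_freeTensorEquiv M N i t
  rw [h, Submodule.map_comp]
  exact (LinearEquiv.finrank_map_eq _ _).symm

theorem finrank_torTermGr {M N : GrMod K n} (hN : N.IsGraded) (i j : ℕ) :
    Module.finrank K (torTermGr M N i j) = Module.finrank K (syzTgr M N i j) := by
  rw [← map_freeTensorEquiv hN]
  exact (LinearEquiv.finrank_map_eq _ _).symm

theorem finiteDimensional_torTermGr {M N : GrMod K n} (hM : M.IsGraded) (hN : N.IsGraded)
    (i j : ℕ) : FiniteDimensional K (torTermGr M N i j) := by
  have := ((hM.syzIter i).grading.tgr hN.grading).fin j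
  change FiniteDimensional K (syzTgr M N i j) at this
  rw [← map_freeTensorEquiv hN] at this
  exact LinearEquiv.finiteDimensional
    ((freeTensorEquiv (syzIter M i) N).submoduleMap (torTermGr M N i j)).symm

/-- The differential preserves degree, so a boundary of degree `j` is already the boundary of an
element of degree `j`. The argument runs over `K`, where the pieces are known to form gradings. -/
theorem torTermGr_inf_range {M N : GrMod K n} (hM : M.IsGraded) (hN : N.IsGraded) (i j : ℕ) :
    torTermGr M N i j ⊓ LinearMap.range ((torD M N i).restrictScalars K) =
      (torTermGr M N (i + 1) j).map ((torD M N i).restrictScalars K) := by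
  have key := inf_range_eq_map ((hM.syzIter (i + 1)).grading.tgr hN.grading).iSup_eq_top
    ((hM.syzIter i).grading.tgr hN.grading).indep (map_syzIterD_le hN i) j
  apply Submodule.map_injective_of_injective (f := (freeTensorEquiv (syzIter M i) N).toLinearMap)
    (freeTensorEquiv (syzIter M i) N).injective
  have h : syzIterD M N i ∘ₗ (freeTensorEquiv (syzIter M (i + 1)) N).toLinearMap =
      (freeTensorEquiv (syzIter M i) N).toLinearMap ∘ₗ (torD M N i).restrictScalars K :=
    LinearMap.ext fun t => syzIterD_freeTensorEquiv M N i t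
  rw [Submodule.map_inf _ (freeTensorEquiv (syzIter M i) N).injective, ← LinearMap.range_comp,
    ← Submodule.map_comp, ← h, Submodule.map_comp, map_freeTensorEquiv hN,
    map_freeTensorEquiv hN, LinearMap.range_comp_of_range_eq_top]
  · exact key
  · exact LinearMap.range_eq_top.2 (freeTensorEquiv (syzIter M (i + 1)) N).surjective

/-- Homogeneous cycles modulo homogeneous boundaries. The natural number `d` replaces the cardinal
dimension, so the later comparisons are integer arithmetic. -/
theorem torDim_add_torRank {M N : GrMod K n} (hM : M.IsGraded) (hN : N.IsGraded) (i j : ℕ) :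
    ∃ d : ℕ, torDim M N i j = d ∧
      d + torRank M N i j = Module.finrank K (torTermGr M N i j ⊓
        (torCycles M N i).restrictScalars K : Submodule K (torTerm M N i)) := by
  have hfin := finiteDimensional_torTermGr hM hN i j
  let c : torCycles M N i →ₗ[K] torTerm M N i := (torCycles M N i).subtype.restrictScalars K
  have hc : Function.Injective c := (torCycles M N i).subtype_injective
  let Z : Submodule K (torCycles M N i) := (torTermGr M N i j).comap c
  have hZc : Z.map c = torTermGr M N i j ⊓ (torCycles M N i).restrictScalars K := by
    rw [Submodule.map_comap_eq, inf_comm]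
    congr 1
    ext x
    constructor
    · rintro ⟨y, rfl⟩
      exact y.2
    · exact fun hx => ⟨⟨x, hx⟩, rfl⟩
  have hZfin : FiniteDimensional K Z :=
    FiniteDimensional.of_injective (c.restrict (q := torTermGr M N i j) fun x (hx : x ∈ Z) => hx)
      fun x y h => by
        have h' := congrArg Subtype.val h
        exact Subtype.ext (hc h')
  let q := ((LinearMap.range (torD M N i)).submoduleOf (torCycles M N i)).mkQ.restrictScalars K
  have h1 := finrank_map_add_finrank_inf_ker q Z
  have h2 : (Z ⊓ LinearMap.ker q).map c =
      torTermGr M N i j ⊓ LinearMap.range ((torD M N i).restrictScalars K) := by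
    ext x
    constructor
    · rintro ⟨y, ⟨hy, hy'⟩, rfl⟩
      exact ⟨hy, (Submodule.Quotient.mk_eq_zero ((LinearMap.range (torD M N i)).submoduleOf
        (torCycles M N i))).1 hy'⟩
    · rintro ⟨hx, hx'⟩
      exact ⟨⟨x, range_torD_le M N i hx'⟩, ⟨hx, (Submodule.Quotient.mk_eq_zero _).2 hx'⟩, rfl⟩
  refine ⟨Module.finrank K (torGr M N i j), ?_, ?_⟩
  · have : FiniteDimensional K (torGr M N i j) :=
      inferInstanceAs (FiniteDimensional K (Z.map q))
    exact (Module.finrank_eq_rank K (torGr M N i j)).symm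
  · rw [← hZc, ← (Submodule.equivMapOfInjective c hc Z).finrank_eq, ← h1,
      (Submodule.equivMapOfInjective c hc (Z ⊓ LinearMap.ker q)).finrank_eq, h2,
      torTermGr_inf_range hM hN, finrank_map_torD hN]
    rfl

/-- Comparison of the dimensions of Tor by comparison of the ranks of the differentials. -/
theorem torDim_le_of_torRank_le {M N M' N' : GrMod K n} (hM : M.IsGraded) (hN : N.IsGraded)
    (hM' : M'.IsGraded) (hN' : N'.IsGraded) {j : ℕ} (h : ∀ d ≤ j, M.hf d = M'.hf d)
    (h' : ∀ d ≤ j, N.hf d = N'.hf d) (hr : ∀ i, torRank M' N' i j ≤ torRank M N i j) (i : ℕ) :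
    torDim M N i j ≤ torDim M' N' i j := by
  obtain ⟨d, hd, e⟩ := torDim_add_torRank hM hN i j
  obtain ⟨d', hd', e'⟩ := torDim_add_torRank hM' hN' i j
  rw [hd, hd', Nat.cast_le]
  have h0 := finrank_syzTgr_congr hM hM' hN hN' h h' i
  have hri := hr i
  -- For `i = 0` every element is a cycle and only the incoming rank is subtracted. For larger `i`
  -- the outgoing rank is subtracted too, by `key`.
  cases i with
  | zero =>
    have h1 : ∀ M N : GrMod K n, torTermGr M N 0 j ⊓ (torCycles M N 0).restrictScalars K =
        torTermGr M N 0 j := fun M N => inf_top_eq _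
    rw [h1, finrank_torTermGr hN] at e
    rw [h1, finrank_torTermGr hN'] at e'
    omega
  | succ i =>
    have key : ∀ {M N : GrMod K n}, M.IsGraded → N.IsGraded → torRank M N i j +
        Module.finrank K (torTermGr M N (i + 1) j ⊓
          (torCycles M N (i + 1)).restrictScalars K : Submodule K (torTerm M N (i + 1))) =
        Module.finrank K (syzTgr M N (i + 1) j) := by
      intro M N hM hN
      have := finiteDimensional_torTermGr hM hN (i + 1) j
      rw [← finrank_torTermGr hN, ← finrank_map_torD hN]
      exact finrank_map_add_finrank_inf_ker ((torD M N i).restrictScalars K) _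
    have k1 := key hM hN
    have k2 := key hM' hN'
    have := hr i
    omega

end GenTor

namespace GenTor

variable {K : Type u} [Field K] {n : ℕ}

/-! # Changes of coordinates -/

theorem coordChange_X (g : GL (Fin n) K) (i : Fin n) :
    coordChange g (MvPolynomial.X i) = ∑ k, MvPolynomial.C (g k i) * MvPolynomial.X k :=
  MvPolynomial.aeval_X _ _

theorem coordChange_one : coordChange (1 : GL (Fin n) K) = AlgHom.id K _ := by
  apply MvPolynomial.algHom_ext
  intro i
  rw [coordChange_X, Finset.sum_eq_single i]
  · simp
  · intro k _ hk
    simp [Matrix.one_apply_ne hk]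
  · simp

theorem coordChange_mul (g h : GL (Fin n) K) :
    coordChange (g * h) = (coordChange g).comp (coordChange h) := by
  apply MvPolynomial.algHom_ext
  intro i
  rw [AlgHom.comp_apply, coordChange_X, coordChange_X, map_sum]
  simp only [map_mul, coordChange_X, MvPolynomial.algHom_C, MvPolynomial.algebraMap_eq,
    Units.val_mul, Matrix.mul_apply, map_sum, Finset.mul_sum, Finset.sum_mul]
  rw [Finset.sum_comm]
  refine Finset.sum_congr rfl fun k _ => Finset.sum_congr rfl fun l _ => ?_
  ring

theorem coordChange_inv_apply (g : GL (Fin n) K) (f : MvPolynomial (Fin n) K) :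
    coordChange g⁻¹ (coordChange g f) = f := by
  rw [← AlgHom.comp_apply, ← coordChange_mul, inv_mul_cancel, coordChange_one, AlgHom.id_apply]

theorem coordChange_apply_inv (g : GL (Fin n) K) (f : MvPolynomial (Fin n) K) :
    coordChange g (coordChange g⁻¹ f) = f := by
  rw [← AlgHom.comp_apply, ← coordChange_mul, mul_inv_cancel, coordChange_one, AlgHom.id_apply]

theorem coordChange_injective (g : GL (Fin n) K) : Function.Injective (coordChange g) :=
  Function.LeftInverse.injective (coordChange_inv_apply g)

theorem coordChange_surjective (g : GL (Fin n) K) : Function.Surjective (coordChange g) :=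
  Function.RightInverse.surjective (coordChange_apply_inv g)

theorem coordChange_mem (g : GL (Fin n) K) {d : ℕ} {f : MvPolynomial (Fin n) K}
    (hf : f ∈ MvPolynomial.homogeneousSubmodule (Fin n) K d) :
    coordChange g f ∈ MvPolynomial.homogeneousSubmodule (Fin n) K d := by
  have := MvPolynomial.IsHomogeneous.aeval (show f.IsHomogeneous d from hf)
    (fun i => ∑ k, MvPolynomial.C (g k i) * MvPolynomial.X k) (n := 1) fun i =>
      MvPolynomial.IsHomogeneous.sum _ _ _ fun k _ => MvPolynomial.isHomogeneous_C_mul_X _ _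
  rwa [one_mul] at this

theorem map_coordChange (g : GL (Fin n) K) (d : ℕ) :
    (MvPolynomial.homogeneousSubmodule (Fin n) K d).map (coordChange g).toLinearMap =
      MvPolynomial.homogeneousSubmodule (Fin n) K d := by
  apply le_antisymm
  · rintro _ ⟨f, hf, rfl⟩
    exact coordChange_mem g hf
  · intro f hf
    exact ⟨_, coordChange_mem g⁻¹ hf, coordChange_apply_inv g f⟩

/-! # Functoriality of syzygies -/

/-- Graded maps that are semilinear for a change of coordinates. -/
structure SMap (g : GL (Fin n) K) (M M' : GrMod K n) where
  toLin : M.carrier →ₗ[K] M'.carrier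
  map_smul : ∀ s x, toLin (s • x) = coordChange g s • toLin x
  map_mem : ∀ d, ∀ x ∈ M.gr d, toLin x ∈ M'.gr d

variable {g : GL (Fin n) K} {M M' N N' : GrMod K n}

/-- The map `S ⊗ M → S ⊗ M'` induced by a semilinear map `M → M'`. -/
def SMap.freeMap (f : SMap g M M') : (freeOn M).carrier →ₗ[K] (freeOn M').carrier :=
  TensorProduct.map (coordChange g).toLinearMap f.toLin

theorem SMap.freeMap_freeTmul (f : SMap g M M') (s : MvPolynomial (Fin n) K) (x : M.carrier) :
    f.freeMap (freeTmul M s x) = freeTmul M' (coordChange g s) (f.toLin x) :=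
  rfl

theorem SMap.cover_freeMap (f : SMap g M M') (z : (freeOn M).carrier) :
    cover M' (f.freeMap z) = f.toLin (cover M z) := by
  induction z using freeOn_induction with
  | h0 => simp only [map_zero]
  | ha z w hz hw => simp only [map_add, hz, hw]
  | ht s x => rw [freeMap_freeTmul, cover_freeTmul, cover_freeTmul, f.map_smul]

theorem SMap.freeMap_unitTmul (f : SMap g M M') (x : M.carrier) :
    f.freeMap (unitTmul M x) = unitTmul M' (f.toLin x) := by
  rw [unitTmul_eq, freeMap_freeTmul, map_one, unitTmul_eq]

theorem SMap.freeMap_smul (f : SMap g M M') (s : MvPolynomial (Fin n) K)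
    (z : (freeOn M).carrier) : f.freeMap (s • z) = coordChange g s • f.freeMap z := by
  induction z using freeOn_induction with
  | h0 => simp only [smul_zero, map_zero]
  | ha z w hz hw => simp only [smul_add, map_add, hz, hw]
  | ht t x =>
    rw [smul_freeTmul, freeMap_freeTmul, freeMap_freeTmul, smul_freeTmul, map_mul]

theorem SMap.map_freeMap (f : SMap g M M') (d : ℕ) :
    ((freeOn M).gr d).map f.freeMap =
      tgr (MvPolynomial.homogeneousSubmodule (Fin n) K) (fun b => (M.gr b).map f.toLin) d := by
  refine (map_tgr _ _ _ _ d).trans ?_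
  simp only [map_coordChange]

theorem SMap.freeMap_mem (f : SMap g M M') {d : ℕ} {z : (freeOn M).carrier}
    (hz : z ∈ (freeOn M).gr d) : f.freeMap z ∈ (freeOn M').gr d := by
  have h : ((freeOn M).gr d).map f.freeMap ≤ (freeOn M').gr d := by
    rw [SMap.map_freeMap]
    refine tgr_mono (fun _ => le_rfl) fun b => ?_
    rintro _ ⟨x, hx, rfl⟩
    exact f.map_mem b x hx
  exact h (Submodule.mem_map_of_mem hz)

/-- The map of first syzygy modules induced by a semilinear map. -/
def SMap.syzLin (f : SMap g M M') : (syz M).carrier →ₗ[K] (syz M').carrier :=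
  toSyz M' ∘ₗ f.freeMap ∘ₗ (syzIncl M).restrictScalars K

theorem SMap.syzIncl_syzLin (f : SMap g M M') (z : (syz M).carrier) :
    syzIncl M' (f.syzLin z) = f.freeMap (syzIncl M z) := by
  change syzIncl M' (toSyz M' (f.freeMap (syzIncl M z))) = _
  rw [syzIncl_toSyz, f.cover_freeMap, cover_syzIncl, map_zero, map_zero, sub_zero]

theorem SMap.syzLin_toSyz (f : SMap g M M') (z : (freeOn M).carrier) :
    f.syzLin (toSyz M z) = toSyz M' (f.freeMap z) := by
  apply syzIncl_injective
  rw [f.syzIncl_syzLin, syzIncl_toSyz, syzIncl_toSyz, map_sub, f.freeMap_unitTmul,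
    f.cover_freeMap]

/-- The semilinear map of first syzygy modules induced by a semilinear map. -/
def SMap.syz (f : SMap g M M') : SMap g (syz M) (syz M') where
  toLin := f.syzLin
  map_smul s z := by
    apply syzIncl_injective
    rw [f.syzIncl_syzLin, _root_.map_smul (syzIncl M), _root_.map_smul (syzIncl M'),
      f.syzIncl_syzLin, f.freeMap_smul]
  map_mem d z hz := by
    rw [mem_syz_gr, f.syzIncl_syzLin]
    exact f.freeMap_mem hz

theorem SMap.syz_toLin (f : SMap g M M') : f.syz.toLin = f.syzLin := rfl

/-- The semilinear map of `i`-th syzygy modules induced by a semilinear map. -/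
def SMap.syzIter (f : SMap g M M') : (i : ℕ) → SMap g (syzIter M i) (syzIter M' i)
  | 0 => f
  | i + 1 => (f.syzIter i).syz

theorem map_toSyz (hM : M.IsGraded) (d : ℕ) : ((freeOn M).gr d).map (toSyz M) = (syz M).gr d := by
  apply le_antisymm
  · rintro _ ⟨z, hz, rfl⟩
    exact toSyz_mem hM hz
  · intro z hz
    exact ⟨syzIncl M z, hz, toSyz_syzIncl M z⟩

/-- The image of the induced map of first syzygy modules. -/
theorem SMap.map_syz (f : SMap g M M') (hM : M.IsGraded) (d : ℕ) :
    ((GenTor.syz M).gr d).map f.syz.toLin =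
      Submodule.map (toSyz M') (tgr (MvPolynomial.homogeneousSubmodule (Fin n) K)
        (fun b => (M.gr b).map f.toLin) d) := by
  rw [← f.map_freeMap, ← map_toSyz hM, ← Submodule.map_comp]
  have h : f.syz.toLin ∘ₗ toSyz M = toSyz M' ∘ₗ f.freeMap :=
    LinearMap.ext fun z => f.syzLin_toSyz z
  rw [h]
  exact Submodule.map_comp _ _ _

theorem SMap.map_syz_eq (f : SMap g M M') (hM : M.IsGraded) (hM' : M'.IsGraded)
    (hf : ∀ d, (M.gr d).map f.toLin = M'.gr d) (d : ℕ) :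
    ((GenTor.syz M).gr d).map f.syz.toLin = (GenTor.syz M').gr d := by
  rw [f.map_syz hM]
  simp only [hf]
  exact map_toSyz hM' d

theorem SMap.map_syzIter_eq (f : SMap g M M') (hM : M.IsGraded) (hM' : M'.IsGraded)
    (hf : ∀ d, (M.gr d).map f.toLin = M'.gr d) (i : ℕ) :
    ∀ d, ((GenTor.syzIter M i).gr d).map (f.syzIter i).toLin = (GenTor.syzIter M' i).gr d := by
  induction i with
  | zero => exact hf
  | succ i ih => exact fun d => (f.syzIter i).map_syz_eq (hM.syzIter i) (hM'.syzIter i) ih d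

theorem tgr_bot_left {V W : Type*} [AddCommGroup V] [Module K V] [AddCommGroup W] [Module K W]
    {A : ℕ → Submodule K V} (hA : ∀ d, A d = ⊥) (B : ℕ → Submodule K W) (j : ℕ) :
    tgr A B j = ⊥ := by
  rw [eq_bot_iff]
  refine tgr_le fun a b h s hs x hx => ?_
  rw [hA, Submodule.mem_bot] at hs
  rw [hs, TensorProduct.zero_tmul]
  exact Submodule.zero_mem _

/-- The kernel of the induced map of first syzygy modules. -/
theorem SMap.syz_inf_ker (f : SMap g M M') (hM : M.IsGraded) (hM' : M'.IsGraded)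
    (hf : ∀ d, (M.gr d).map f.toLin = M'.gr d) (d : ℕ) :
    (GenTor.syz M).gr d ⊓ LinearMap.ker f.syz.toLin =
      Submodule.map (toSyz M) (tgr (MvPolynomial.homogeneousSubmodule (Fin n) K)
        (fun b => M.gr b ⊓ LinearMap.ker f.toLin) d) := by
  have key : (freeOn M).gr d ⊓ LinearMap.ker f.freeMap =
      tgr (MvPolynomial.homogeneousSubmodule (Fin n) K)
        (fun b => M.gr b ⊓ LinearMap.ker f.toLin) d := by
    refine (tgr_inf_ker isGrading_homogeneousSubmodule hM'.grading (map_coordChange g) hf d).trans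
      ?_
    rw [tgr_bot_left, bot_sup_eq]
    intro a
    rw [LinearMap.ker_eq_bot.2 (show Function.Injective (coordChange g).toLinearMap from
      coordChange_injective g), inf_bot_eq]
  rw [← key]
  apply le_antisymm
  · rintro z ⟨hz, hz'⟩
    refine ⟨syzIncl M z, ⟨hz, ?_⟩, toSyz_syzIncl M z⟩
    have h1 : f.syzLin z = 0 := hz'
    change f.freeMap (syzIncl M z) = 0
    rw [← f.syzIncl_syzLin, h1, map_zero]
  · rintro _ ⟨z, ⟨hz, hz'⟩, rfl⟩
    have h1 : f.freeMap z = 0 := hz'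
    refine ⟨toSyz_mem hM hz, ?_⟩
    change f.syzLin (toSyz M z) = 0
    rw [f.syzLin_toSyz, h1, map_zero]

/-- Over a field the tensor product of injective maps is injective, so the induced map of free
covers is injective and restricts to the syzygies. -/
theorem SMap.syz_injective (f : SMap g M M') (hf : Function.Injective f.toLin) :
    Function.Injective f.syz.toLin := by
  have h : Function.Injective f.freeMap :=
    TensorProduct.map_injective_of_flat_flat _ _ (coordChange_injective g) hf
  intro z w hzw
  apply syzIncl_injective
  apply h
  rw [← f.syzIncl_syzLin, ← f.syzIncl_syzLin]
  exact congrArg _ hzw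

theorem SMap.syzIter_injective (f : SMap g M M') (hf : Function.Injective f.toLin) (i : ℕ) :
    Function.Injective (f.syzIter i).toLin := by
  induction i with
  | zero => exact hf
  | succ i ih => exact (f.syzIter i).syz_injective ih

theorem SMap.map_freeAct (f : SMap g M M') (h : SMap g N N') (z : (freeOn M).carrier)
    (y : N.carrier) :
    TensorProduct.map f.toLin h.toLin (freeAct M N z y) =
      freeAct M' N' (f.freeMap z) (h.toLin y) := by
  induction z using freeOn_induction with
  | h0 => simp only [map_zero, LinearMap.zero_apply]
  | ha z w hz hw => simp only [map_add, LinearMap.add_apply, hz, hw]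
  | ht s x =>
    rw [freeAct_freeTmul, freeMap_freeTmul, freeAct_freeTmul, TensorProduct.map_tmul, h.map_smul]

theorem SMap.map_syzD (f : SMap g M M') (h : SMap g N N') :
    TensorProduct.map f.toLin h.toLin ∘ₗ syzD M N =
      syzD M' N' ∘ₗ TensorProduct.map f.syz.toLin h.toLin := by
  apply TensorProduct.ext'
  intro z y
  rw [LinearMap.comp_apply, LinearMap.comp_apply, TensorProduct.map_tmul, syzD_tmul, syzD_tmul,
    f.map_freeAct, f.syz_toLin, f.syzIncl_syzLin]

/-- The map `syz^i(M) ⊗ N → syz^i(M') ⊗ N'` induced by two semilinear maps. -/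
def torMap (f : SMap g M M') (h : SMap g N N') (i : ℕ) :
    (syzIter M i).carrier ⊗[K] N.carrier →ₗ[K] (syzIter M' i).carrier ⊗[K] N'.carrier :=
  TensorProduct.map (f.syzIter i).toLin h.toLin

theorem torMap_comp_syzIterD (f : SMap g M M') (h : SMap g N N') (i : ℕ) :
    torMap f h i ∘ₗ syzIterD M N i = syzIterD M' N' i ∘ₗ torMap f h (i + 1) :=
  (f.syzIter i).map_syzD h

theorem map_torMap (f : SMap g M M') (h : SMap g N N') (hM : M.IsGraded) (hM' : M'.IsGraded)
    (hf : ∀ d, (M.gr d).map f.toLin = M'.gr d) (hh : ∀ d, (N.gr d).map h.toLin = N'.gr d)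
    (i j : ℕ) : (syzTgr M N i j).map (torMap f h i) = syzTgr M' N' i j := by
  refine (map_tgr _ _ _ _ j).trans ?_
  simp only [f.map_syzIter_eq hM hM' hf, hh]

/-- The ranks of the differentials do not grow under semilinear surjections. -/
theorem torRank_le_of_surjective (f : SMap g M M') (h : SMap g N N') (hM : M.IsGraded)
    (hM' : M'.IsGraded) (hN : N.IsGraded)
    (hf : ∀ d, (M.gr d).map f.toLin = M'.gr d) (hh : ∀ d, (N.gr d).map h.toLin = N'.gr d)
    (i j : ℕ) : torRank M' N' i j ≤ torRank M N i j := by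
  have := ((hM.syzIter (i + 1)).grading.tgr hN.grading).fin j
  rw [torRank, ← map_torMap f h hM hM' hf hh, ← Submodule.map_comp, ← torMap_comp_syzIterD,
    Submodule.map_comp]
  exact Submodule.finrank_map_le _ _

end GenTor

namespace GenTor

/-! # Polynomial families of subspaces -/

section Families

variable {K : Type*} [Field K] {V W U : Type*} [AddCommGroup V] [Module K V]
  [AddCommGroup W] [Module K W] [AddCommGroup U] [Module K U] {σ X : Type*}

/-- The polynomial maps from affine space to a vector space. -/
def polyMaps (K σ V : Type*) [Field K] [AddCommGroup V] [Module K V] :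
    Submodule K ((σ → K) → V) :=
  Submodule.span K {c | ∃ (f : MvPolynomial σ K) (v : V), c = fun p => MvPolynomial.eval p f • v}

theorem polyMaps_smul (f : MvPolynomial σ K) (v : V) :
    (fun p => MvPolynomial.eval p f • v) ∈ polyMaps K σ V :=
  Submodule.subset_span ⟨f, v, rfl⟩

theorem polyMaps_const (v : V) : (fun _ => v) ∈ polyMaps K σ V := by
  simpa using polyMaps_smul (K := K) (σ := σ) 1 v

theorem polyMaps_comp (L : V →ₗ[K] W) {c : (σ → K) → V} (hc : c ∈ polyMaps K σ V) :
    (fun p => L (c p)) ∈ polyMaps K σ W := by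
  have h : polyMaps K σ V ≤ (polyMaps K σ W).comap (L.compLeft (σ → K)) := by
    refine Submodule.span_le.2 ?_
    rintro _ ⟨f, v, rfl⟩
    have : L.compLeft (σ → K) (fun p => MvPolynomial.eval p f • v) =
        fun p => MvPolynomial.eval p f • L v := by
      ext p
      simp
    change L.compLeft (σ → K) (fun p => MvPolynomial.eval p f • v) ∈ polyMaps K σ W
    rw [this]
    exact polyMaps_smul f (L v)
  exact h hc

theorem polyMaps_eval_smul (f : MvPolynomial σ K) {c : (σ → K) → V} (hc : c ∈ polyMaps K σ V) :
    (fun p => MvPolynomial.eval p f • c p) ∈ polyMaps K σ V := by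
  induction hc using Submodule.span_induction with
  | mem c h =>
    obtain ⟨g, v, rfl⟩ := h
    simpa only [smul_smul, ← map_mul] using polyMaps_smul (f * g) v
  | zero =>
    have : (fun p => MvPolynomial.eval p f • (0 : (σ → K) → V) p) = 0 := by
      ext p; simp
    rw [this]
    exact Submodule.zero_mem _
  | add c d _ _ hc hd =>
    have := Submodule.add_mem _ hc hd
    have e : (fun p => MvPolynomial.eval p f • (c + d) p) =
      (fun p => MvPolynomial.eval p f • c p) + fun p => MvPolynomial.eval p f • d p := by
        ext p; simp
    rwa [e]
  | smul a c _ hc =>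
    have := Submodule.smul_mem _ a hc
    have e : (fun p => MvPolynomial.eval p f • (a • c) p) =
      a • (fun p => MvPolynomial.eval p f • c p) := by
        ext p; exact smul_comm _ _ _
    rwa [e]

/-- Applied to the tensor product (`Lifts.tgr`) and to multiplication of polynomials
(`polyMaps_substitution`). -/
theorem polyMaps_bilin (B : V →ₗ[K] W →ₗ[K] U) {c : (σ → K) → V} {d : (σ → K) → W}
    (hc : c ∈ polyMaps K σ V) (hd : d ∈ polyMaps K σ W) :
    (fun p => B (c p) (d p)) ∈ polyMaps K σ U := by
  induction hc using Submodule.span_induction with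
  | mem c h =>
    obtain ⟨f, v, rfl⟩ := h
    simpa only [map_smul, LinearMap.smul_apply] using polyMaps_eval_smul f (polyMaps_comp (B v) hd)
  | zero =>
    have : (fun p => B ((0 : (σ → K) → V) p) (d p)) = 0 := by
      ext p; simp
    rw [this]
    exact Submodule.zero_mem _
  | add c c' _ _ hc hc' =>
    have := Submodule.add_mem _ hc hc'
    have e : (fun p => B ((c + c') p) (d p)) = (fun p => B (c p) (d p)) + fun p => B (c' p) (d p) :=
      by ext p; simp
    rwa [e]
  | smul a c _ hc =>
    have := Submodule.smul_mem _ a hc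
    have e : (fun p => B ((a • c) p) (d p)) = a • (fun p => B (c p) (d p)) := by
      ext p; simp
    rwa [e]

theorem exists_polynomial_of_mem_polyMaps {c : (σ → K) → K} (hc : c ∈ polyMaps K σ K) :
    ∃ f : MvPolynomial σ K, ∀ p, c p = MvPolynomial.eval p f := by
  induction hc using Submodule.span_induction with
  | mem c h =>
    obtain ⟨f, v, rfl⟩ := h
    exact ⟨f * MvPolynomial.C v, fun p => by simp⟩
  | zero => exact ⟨0, fun p => by simp⟩
  | add c d _ _ hc hd =>
    obtain ⟨f, hf⟩ := hc
    obtain ⟨g, hg⟩ := hd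
    exact ⟨f + g, fun p => by simp [hf, hg]⟩
  | smul a c _ hc =>
    obtain ⟨f, hf⟩ := hc
    exact ⟨MvPolynomial.C a * f, fun p => by simp [hf]⟩

/-- Every element of `A x₀` extends to a polynomial family of elements of the `A x`, where `X` is
a set of points of affine space. -/
def Lifts (ev : X → σ → K) (x₀ : X) (A : X → Submodule K V) : Prop :=
  ∀ v ∈ A x₀, ∃ c ∈ polyMaps K σ V, c (ev x₀) = v ∧ ∀ x, c (ev x) ∈ A x

variable {ev : X → σ → K} {x₀ : X}

theorem Lifts.const (A : Submodule K V) : Lifts ev x₀ fun _ => A :=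
  fun v hv => ⟨_, polyMaps_const v, rfl, fun _ => hv⟩

theorem Lifts.congr {A B : X → Submodule K V} (hB : Lifts ev x₀ B) (h : ∀ x, A x = B x) :
    Lifts ev x₀ A := by
  rwa [funext h]

theorem Lifts.map {A : X → Submodule K V} (hA : Lifts ev x₀ A) (L : V →ₗ[K] W) :
    Lifts ev x₀ fun x => (A x).map L := by
  rintro _ ⟨v, hv, rfl⟩
  obtain ⟨c, hc, h, h'⟩ := hA v hv
  exact ⟨_, polyMaps_comp L hc, congrArg L h, fun x => Submodule.mem_map_of_mem (h' x)⟩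

/-- It suffices to lift a spanning set. -/
theorem Lifts.of_span {A : X → Submodule K V} (s : Set V) (hs : A x₀ ≤ Submodule.span K s)
    (h : ∀ v ∈ s, ∃ c ∈ polyMaps K σ V, c (ev x₀) = v ∧ ∀ x, c (ev x) ∈ A x) :
    Lifts ev x₀ A := by
  let L : Submodule K V :=
    { carrier := {v | ∃ c ∈ polyMaps K σ V, c (ev x₀) = v ∧ ∀ x, c (ev x) ∈ A x}
      zero_mem' := ⟨0, Submodule.zero_mem _, rfl, fun x => Submodule.zero_mem _⟩
      add_mem' := by
        rintro _ _ ⟨c, hc, rfl, hcA⟩ ⟨d, hd, rfl, hdA⟩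
        exact ⟨c + d, Submodule.add_mem _ hc hd, rfl, fun x =>
          Submodule.add_mem _ (hcA x) (hdA x)⟩
      smul_mem' := by
        rintro a _ ⟨c, hc, rfl, hcA⟩
        exact ⟨a • c, Submodule.smul_mem _ a hc, rfl, fun x => Submodule.smul_mem _ a (hcA x)⟩ }
  exact fun v hv => (Submodule.span_le (p := L)).2 h (hs hv)

theorem Lifts.sup {A B : X → Submodule K V} (hA : Lifts ev x₀ A) (hB : Lifts ev x₀ B) :
    Lifts ev x₀ fun x => A x ⊔ B x := by
  intro v hv
  obtain ⟨a, ha, b, hb, rfl⟩ := Submodule.mem_sup.1 hv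
  obtain ⟨c, hc, rfl, h'⟩ := hA a ha
  obtain ⟨d, hd, rfl, k'⟩ := hB b hb
  exact ⟨c + d, Submodule.add_mem _ hc hd, rfl, fun x => Submodule.add_mem_sup (h' x) (k' x)⟩

theorem Lifts.tgr {A : X → ℕ → Submodule K V} {B : X → ℕ → Submodule K W} {j : ℕ}
    (hA : ∀ a ≤ j, Lifts ev x₀ fun x => A x a) (hB : ∀ b ≤ j, Lifts ev x₀ fun x => B x b) :
    Lifts ev x₀ fun x => tgr (A x) (B x) j := by
  refine Lifts.of_span _ le_rfl ?_
  rintro _ ⟨a, b, h, v, hv, w, hw, rfl⟩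
  obtain ⟨c, hc, rfl, h'⟩ := hA a (by omega) v hv
  obtain ⟨d, hd, rfl, k'⟩ := hB b (by omega) w hw
  exact ⟨_, polyMaps_bilin (TensorProduct.mk K V W) hc hd, rfl, fun x =>
    tmul_mem_tgr h (h' x) (k' x)⟩

/-- Lower semicontinuity of the dimension in a polynomial family. -/
theorem Lifts.finrank_le {A : X → Submodule K V} (hA : Lifts ev x₀ A)
    (hfin : ∀ x, FiniteDimensional K (A x)) :
    ∃ f : MvPolynomial σ K, MvPolynomial.eval (ev x₀) f ≠ 0 ∧
      ∀ x, MvPolynomial.eval (ev x) f ≠ 0 →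
        Module.finrank K (A x₀) ≤ Module.finrank K (A x) := by
  classical
  set r := Module.finrank K (A x₀) with hr
  have := hfin x₀
  let b := Module.finBasis K (A x₀)
  choose c hc hc0 hcA using fun k => hA (b k) (b k).2
  have hli : LinearIndependent K fun k => (b k : V) :=
    b.linearIndependent.map' (A x₀).subtype (Submodule.ker_subtype _)
  -- `L` reads off coordinates with respect to a basis of `A x₀`, extended linearly to all of `V`.
  -- The determinant of the coordinates of the lifted basis is a polynomial with value 1 at `x₀`;
  -- where it is nonzero the lifted vectors stay independent.
  obtain ⟨L, hL⟩ := LinearMap.exists_leftInverse_of_injective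
    (Fintype.linearCombination K fun k => (b k : V))
    (LinearMap.ker_eq_bot.2 (linearIndependent_iff_injective_fintypeLinearCombination.1 hli))
  have hLb : ∀ k, L (b k) = Pi.single k 1 := by
    intro k
    have := LinearMap.congr_fun hL (Pi.single k 1)
    simpa using this
  choose F hF using fun k l => exists_polynomial_of_mem_polyMaps
    (polyMaps_comp (LinearMap.proj l ∘ₗ L) (hc k))
  let D : MvPolynomial σ K := (Matrix.of F).det
  have hD : ∀ p, MvPolynomial.eval p D = (Matrix.of fun k l => L (c k p) l).det := by
    intro p
    simp only [D, RingHom.map_det]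
    congr 1
    ext k l
    simp [← hF]
  refine ⟨D, ?_, fun x hx => ?_⟩
  · rw [hD]
    have : (Matrix.of fun k l => L (c k (ev x₀)) l) = 1 := by
      ext k l
      simp [hc0, hLb, Matrix.one_apply, Pi.single_apply, eq_comm]
    rw [this, Matrix.det_one]
    exact one_ne_zero
  · rw [hD] at hx
    have h1 := Matrix.linearIndependent_rows_of_det_ne_zero hx
    have h2 : LinearIndependent K fun k => L (c k (ev x)) := h1
    have h3 : LinearIndependent K fun k => c k (ev x) := LinearIndependent.of_comp L h2
    have h4 : LinearIndependent K fun k => (⟨c k (ev x), hcA k x⟩ : A x) :=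
      LinearIndependent.of_comp (A x).subtype h3
    have := hfin x
    simpa using h4.fintype_card_le_finrank

/-- Lower semicontinuity of the dimension of the images of a polynomial family under linear maps
whose kernels form a polynomial family of constant dimension. -/
theorem Lifts.finrank_map_le {A : X → Submodule K V} (hA : Lifts ev x₀ A) {G : Submodule K V}
    [FiniteDimensional K G] (hAG : ∀ x, A x ≤ G) {W : X → Type*} [∀ x, AddCommGroup (W x)]
    [∀ x, Module K (W x)] (T : ∀ x, V →ₗ[K] W x)
    (hT : Lifts ev x₀ fun x => G ⊓ LinearMap.ker (T x))
    (hconst : ∀ x, Module.finrank K (G.map (T x)) = Module.finrank K (G.map (T x₀))) :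
    ∃ f : MvPolynomial σ K, MvPolynomial.eval (ev x₀) f ≠ 0 ∧
      ∀ x, MvPolynomial.eval (ev x) f ≠ 0 →
        Module.finrank K ((A x₀).map (T x₀)) ≤ Module.finrank K ((A x).map (T x)) := by
  have hle : ∀ x, A x ⊔ (G ⊓ LinearMap.ker (T x)) ≤ G := fun x => sup_le (hAG x) inf_le_left
  have hfin : ∀ x, FiniteDimensional K (A x ⊔ (G ⊓ LinearMap.ker (T x)) : Submodule K V) :=
    fun x => Submodule.finiteDimensional_of_le (hle x)
  obtain ⟨f, hf0, hf⟩ := (hA.sup hT).finrank_le hfin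
  refine ⟨f, hf0, fun x hx => ?_⟩
  -- The dimension of `T(A)` is that of `A + (G ∩ ker T)` minus that of `G ∩ ker T`. The latter is
  -- `dim G - dim T(G)`, hence constant, so semicontinuity of the sum is enough.
  have key : ∀ x, Module.finrank K ((A x).map (T x)) + Module.finrank K G =
      Module.finrank K (A x ⊔ (G ⊓ LinearMap.ker (T x)) : Submodule K V) +
        Module.finrank K (G.map (T x)) := by
    intro x
    have := hfin x
    have h1 := finrank_map_add_finrank_inf_ker (T x) (A x ⊔ (G ⊓ LinearMap.ker (T x)))
    have h2 : (A x ⊔ (G ⊓ LinearMap.ker (T x))).map (T x) = (A x).map (T x) := by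
      rw [Submodule.map_sup, sup_eq_left]
      rintro _ ⟨v, ⟨_, hv⟩, rfl⟩
      rw [LinearMap.mem_ker.1 hv]
      exact Submodule.zero_mem _
    have h3 : (A x ⊔ (G ⊓ LinearMap.ker (T x))) ⊓ LinearMap.ker (T x) =
        G ⊓ LinearMap.ker (T x) :=
      le_antisymm (inf_le_inf_right _ (hle x)) (le_inf le_sup_right inf_le_right)
    have h4 := finrank_map_add_finrank_inf_ker (T x) G
    rw [h2, h3] at h1
    omega
  have h0 := key x₀
  have h1 := key x
  have h2 := hf x hx
  have h3 := hconst x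
  omega

end Families

end GenTor

namespace GenTor

variable {K : Type u} [Field K] {n : ℕ}

/-! # Semicontinuity of Tor in families of ideals -/

/-- The degree `d` piece of an ideal. -/
def degPart (I : Ideal (MvPolynomial (Fin n) K)) (d : ℕ) : Submodule K (MvPolynomial (Fin n) K) :=
  MvPolynomial.homogeneousSubmodule (Fin n) K d ⊓ I.restrictScalars K

theorem coordChange_one_apply (f : MvPolynomial (Fin n) K) :
    coordChange (1 : GL (Fin n) K) f = f := by
  rw [coordChange_one, AlgHom.id_apply]

/-- The quotient map `S → S/I`. -/
def quotMap (I : Ideal (MvPolynomial (Fin n) K)) : SMap 1 (polyMod K n) (quotMod I) where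
  toLin := (Ideal.Quotient.mkₐ K I).toLinearMap
  map_smul s x := by
    rw [coordChange_one_apply]
    rfl
  map_mem _ x hx := ⟨x, hx, rfl⟩

/-- The inclusion `I → S`. -/
def inclMap (I : Ideal (MvPolynomial (Fin n) K)) : SMap 1 (idealMod I) (polyMod K n) where
  toLin := I.subtype.restrictScalars K
  map_smul s x := by
    rw [coordChange_one_apply]
    rfl
  map_mem _ _ hx := hx

/-- The identity of `M`. -/
def idMap (M : GrMod K n) : SMap 1 M M where
  toLin := LinearMap.id
  map_smul s x := by
    rw [coordChange_one_apply]
    rfl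
  map_mem _ _ hx := hx

theorem SMap.syz_toLin_eq_id {M : GrMod K n} {f : SMap 1 M M} (hf : f.toLin = LinearMap.id) :
    f.syz.toLin = LinearMap.id := by
  have h : ∀ z, f.freeMap z = z := by
    intro z
    induction z using freeOn_induction with
    | h0 => exact map_zero _
    | ha z w hz hw => rw [map_add, hz, hw]
    | ht s x => rw [freeMap_freeTmul, hf, coordChange_one_apply, LinearMap.id_apply]
  refine LinearMap.ext fun z => syzIncl_injective M ?_
  rw [f.syz_toLin, f.syzIncl_syzLin, h, LinearMap.id_apply]

theorem idMap_syzIter (M : GrMod K n) (i : ℕ) : ((idMap M).syzIter i).toLin = LinearMap.id := by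
  induction i with
  | zero => rfl
  | succ i ih => exact SMap.syz_toLin_eq_id ih

theorem map_quotMap (I : Ideal (MvPolynomial (Fin n) K)) (d : ℕ) :
    ((polyMod K n).gr d).map (quotMap I).toLin = (quotMod I).gr d :=
  rfl

theorem inf_ker_quotMap (I : Ideal (MvPolynomial (Fin n) K)) (d : ℕ) :
    (polyMod K n).gr d ⊓ LinearMap.ker (quotMap I).toLin = degPart I d := by
  refine congrArg ((polyMod K n).gr d ⊓ ·) ?_
  ext f
  exact Ideal.Quotient.eq_zero_iff_mem

theorem map_inclMap (I : Ideal (MvPolynomial (Fin n) K)) (d : ℕ) :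
    ((idealMod I).gr d).map (inclMap I).toLin = degPart I d := by
  ext f
  constructor
  · rintro ⟨f, hf, rfl⟩
    exact ⟨hf, f.2⟩
  · rintro ⟨hf, hf'⟩
    exact ⟨⟨f, hf'⟩, hf, rfl⟩

theorem hf_idealMod (I : Ideal (MvPolynomial (Fin n) K)) (d : ℕ) :
    (idealMod I).hf d = Module.finrank K (degPart I d) := by
  rw [← map_inclMap]
  exact (Submodule.equivMapOfInjective (inclMap I).toLin I.subtype_injective _).finrank_eq

theorem hf_quotMod_add (I : Ideal (MvPolynomial (Fin n) K)) (d : ℕ) :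
    (quotMod I).hf d + Module.finrank K (degPart I d) = (polyMod K n).hf d := by
  have := (isGrading_homogeneousSubmodule (K := K) (n := n)).fin d
  have : FiniteDimensional K ((polyMod K n).gr d) := this
  rw [← inf_ker_quotMap]
  exact finrank_map_add_finrank_inf_ker (quotMap I).toLin ((polyMod K n).gr d)

variable {σ X : Type*} {ev : X → σ → K} {x₀ : X} {Q J : X → Ideal (MvPolynomial (Fin n) K)}
  {j : ℕ}

/-- The kernel at stage `i + 1` comes from the kernel at stage `i` by tensoring with `S` and
applying the fixed map `toSyz` (`SMap.syz_inf_ker`). Both operations preserve lifting. -/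
theorem lifts_syzIter_inf_ker (hQ : ∀ x, IsHomog (Q x))
    (hl : ∀ d ≤ j, Lifts ev x₀ fun x => degPart (Q x) d) (i : ℕ) :
    ∀ d ≤ j, Lifts ev x₀ fun x => (syzIter (polyMod K n) i).gr d ⊓
      LinearMap.ker ((quotMap (Q x)).syzIter i).toLin := by
  induction i with
  | zero =>
    intro d hd
    simp only [← inf_ker_quotMap] at hl
    exact hl d hd
  | succ i ih =>
    intro d hd
    have h := fun x => ((quotMap (Q x)).syzIter i).syz_inf_ker (polyMod_isGraded.syzIter i)
      ((quotMod_isGraded (hQ x)).syzIter i)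
      ((quotMap (Q x)).map_syzIter_eq polyMod_isGraded (quotMod_isGraded (hQ x))
        (map_quotMap (Q x)) i) d
    have key : Lifts ev x₀ fun x => tgr (MvPolynomial.homogeneousSubmodule (Fin n) K)
        (fun b => (syzIter (polyMod K n) i).gr b ⊓
          LinearMap.ker ((quotMap (Q x)).syzIter i).toLin) d :=
      Lifts.tgr (fun _ _ => Lifts.const _) fun b hb => ih b (hb.trans hd)
    exact (key.map (toSyz (syzIter (polyMod K n) i))).congr h

theorem lifts_map_syzIter_inclMap (hQ : ∀ x, IsHomog (Q x))
    (hl : ∀ d ≤ j, Lifts ev x₀ fun x => degPart (Q x) d) (i : ℕ) :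
    ∀ d ≤ j, Lifts ev x₀ fun x => ((syzIter (idealMod (Q x)) i).gr d).map
      ((inclMap (Q x)).syzIter i).toLin := by
  induction i with
  | zero =>
    intro d hd
    simp only [← map_inclMap] at hl
    exact hl d hd
  | succ i ih =>
    intro d hd
    have h := fun x => ((inclMap (Q x)).syzIter i).map_syz ((idealMod_isGraded (hQ x)).syzIter i) d
    have key : Lifts ev x₀ fun x => tgr (MvPolynomial.homogeneousSubmodule (Fin n) K)
        (fun b => ((syzIter (idealMod (Q x)) i).gr b).map ((inclMap (Q x)).syzIter i).toLin) d :=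
      Lifts.tgr (fun _ _ => Lifts.const _) fun b hb => ih b (hb.trans hd)
    exact (key.map (toSyz (syzIter (polyMod K n) i))).congr h

/-- Every complex in the family is a quotient of the fixed complex of the pair `(S, S)`. Its rank is
the dimension of the image of one fixed space of boundaries under a varying surjection. The kernels
of these surjections lift, and constant Hilbert functions keep their dimension constant. -/
theorem exists_torRank_quotMod_le (hQ : ∀ x, IsHomog (Q x)) (hJ : ∀ x, IsHomog (J x))
    (hQl : ∀ d ≤ j, Lifts ev x₀ fun x => degPart (Q x) d)
    (hJl : ∀ d ≤ j, Lifts ev x₀ fun x => degPart (J x) d)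
    (hQf : ∀ d ≤ j, ∀ x, (quotMod (Q x)).hf d = (quotMod (Q x₀)).hf d)
    (hJf : ∀ d ≤ j, ∀ x, (quotMod (J x)).hf d = (quotMod (J x₀)).hf d) (i : ℕ) :
    ∃ f : MvPolynomial σ K, MvPolynomial.eval (ev x₀) f ≠ 0 ∧
      ∀ x, MvPolynomial.eval (ev x) f ≠ 0 →
        torRank (quotMod (Q x₀)) (quotMod (J x₀)) i j ≤
          torRank (quotMod (Q x)) (quotMod (J x)) i j := by
  let S := polyMod K n
  have hS : S.IsGraded := polyMod_isGraded
  have hfin := ((hS.syzIter i).grading.tgr hS.grading).fin j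
  let T := fun x => torMap (quotMap (Q x)) (quotMap (J x)) i
  have hG : ∀ x, (syzTgr S S i j).map (T x) = syzTgr (quotMod (Q x)) (quotMod (J x)) i j :=
    fun x => map_torMap _ _ hS (quotMod_isGraded (hQ x)) (map_quotMap _) (map_quotMap _) i j
  have hT : Lifts ev x₀ fun x => syzTgr S S i j ⊓ LinearMap.ker (T x) := by
    have h := fun x => tgr_inf_ker ((quotMod_isGraded (hQ x)).syzIter i).grading
      (quotMod_isGraded (hJ x)).grading
      ((quotMap (Q x)).map_syzIter_eq hS (quotMod_isGraded (hQ x)) (map_quotMap (Q x)) i)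
      (map_quotMap (J x)) j
    refine Lifts.congr ?_ h
    exact Lifts.sup (Lifts.tgr (lifts_syzIter_inf_ker hQ hQl i) fun _ _ => Lifts.const _)
      (Lifts.tgr (fun _ _ => Lifts.const _) fun b hb =>
        (hJl b hb).congr fun x => inf_ker_quotMap (J x) b)
  have hA : Lifts ev x₀ fun _ => (syzTgr S S (i + 1) j).map (syzIterD S S i) := Lifts.const _
  obtain ⟨f, hf0, hf⟩ := hA.finrank_map_le (G := syzTgr S S i j)
    (fun _ => map_syzIterD_le hS i j) T hT fun x => by
      rw [hG, hG]
      exact finrank_syzTgr_congr (quotMod_isGraded (hQ x)) (quotMod_isGraded (hQ x₀))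
        (quotMod_isGraded (hJ x)) (quotMod_isGraded (hJ x₀)) (fun d hd => hQf d hd x)
        (fun d hd => hJf d hd x) i
  have hr : ∀ x, Module.finrank K (((syzTgr S S (i + 1) j).map (syzIterD S S i)).map (T x)) =
      torRank (quotMod (Q x)) (quotMod (J x)) i j := by
    intro x
    rw [← Submodule.map_comp, torMap_comp_syzIterD, Submodule.map_comp,
      map_torMap _ _ hS (quotMod_isGraded (hQ x)) (map_quotMap _) (map_quotMap _)]
    rfl
  refine ⟨f, hf0, fun x hx => ?_⟩
  rw [← hr, ← hr]
  exact hf x hx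

/-- Here the first argument is a submodule of `S` and only the second a quotient. The moving ideal
`Q x` enters through the subspace `B x` being mapped, and `J x` through the kernel of the map. -/
theorem exists_torRank_idealMod_le (hQ : ∀ x, IsHomog (Q x)) (hJ : ∀ x, IsHomog (J x))
    (hQl : ∀ d ≤ j, Lifts ev x₀ fun x => degPart (Q x) d)
    (hJl : ∀ d ≤ j, Lifts ev x₀ fun x => degPart (J x) d)
    (hJf : ∀ d ≤ j, ∀ x, (quotMod (J x)).hf d = (quotMod (J x₀)).hf d) (i : ℕ) :
    ∃ f : MvPolynomial σ K, MvPolynomial.eval (ev x₀) f ≠ 0 ∧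
      ∀ x, MvPolynomial.eval (ev x) f ≠ 0 →
        torRank (idealMod (Q x₀)) (quotMod (J x₀)) i j ≤
          torRank (idealMod (Q x)) (quotMod (J x)) i j := by
  let S := polyMod K n
  have hS : S.IsGraded := polyMod_isGraded
  have hfin := ((hS.syzIter i).grading.tgr hS.grading).fin j
  have hid : ∀ (M : GrMod K n) (i d : ℕ),
      ((syzIter M i).gr d).map ((idMap M).syzIter i).toLin = (syzIter M i).gr d := by
    intro M i d
    rw [idMap_syzIter, Submodule.map_id]
  let T := fun x => torMap (idMap S) (quotMap (J x)) i
  have hG : ∀ x, (syzTgr S S i j).map (T x) = syzTgr S (quotMod (J x)) i j :=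
    fun x => map_torMap _ _ hS hS (hid S 0) (map_quotMap _) i j
  have hT : Lifts ev x₀ fun x => syzTgr S S i j ⊓ LinearMap.ker (T x) := by
    have h := fun x => tgr_inf_ker (hS.syzIter i).grading
      (quotMod_isGraded (hJ x)).grading (hid S i) (map_quotMap (J x)) j
    refine Lifts.congr ?_ h
    exact Lifts.sup (Lifts.const _) (Lifts.tgr (fun _ _ => Lifts.const _) fun b hb =>
      (hJl b hb).congr fun x => inf_ker_quotMap (J x) b)
  let B := fun x => tgr (fun d => ((syzIter (idealMod (Q x)) (i + 1)).gr d).map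
    ((inclMap (Q x)).syzIter (i + 1)).toLin) S.gr j
  have hB : Lifts ev x₀ B :=
    Lifts.tgr (lifts_map_syzIter_inclMap hQ hQl (i + 1)) fun _ _ => Lifts.const _
  have hBle : ∀ x, B x ≤ syzTgr S S (i + 1) j := by
    intro x
    refine tgr_mono (fun d => ?_) fun _ => le_rfl
    rintro _ ⟨z, hz, rfl⟩
    exact ((inclMap (Q x)).syzIter (i + 1)).map_mem d z hz
  obtain ⟨f, hf0, hf⟩ := (hB.map (syzIterD S S i)).finrank_map_le (G := syzTgr S S i j)
    (fun x => (Submodule.map_mono (hBle x)).trans (map_syzIterD_le hS i j)) T hT fun x => by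
      rw [hG, hG]
      exact finrank_syzTgr_congr hS hS (quotMod_isGraded (hJ x)) (quotMod_isGraded (hJ x₀))
        (fun _ _ => rfl) (fun d hd => hJf d hd x) i
  have hr : ∀ x, Module.finrank K (((B x).map (syzIterD S S i)).map (T x)) =
      torRank (idealMod (Q x)) (quotMod (J x)) i j := by
    intro x
    let N := quotMod (J x)
    have h1 : (B x).map (torMap (idMap S) (quotMap (J x)) (i + 1)) =
        (syzTgr (idealMod (Q x)) N (i + 1) j).map (torMap (inclMap (Q x)) (idMap N) (i + 1)) := by
      rw [torMap, torMap, map_tgr, map_tgr, idMap_syzIter]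
      simp only [Submodule.map_id]
      congr 1
      funext d
      exact (Submodule.map_id _).symm
    -- Injectivity lets the rank of the complex of the ideal be read inside the complex of `S`.
    have h2 : Function.Injective (torMap (inclMap (Q x)) (idMap N) i) :=
      TensorProduct.map_injective_of_flat_flat _ _
        ((inclMap (Q x)).syzIter_injective (Q x).subtype_injective i) Function.injective_id
    rw [← Submodule.map_comp, torMap_comp_syzIterD, Submodule.map_comp, h1, ← Submodule.map_comp,
      ← torMap_comp_syzIterD, Submodule.map_comp]
    exact (Submodule.equivMapOfInjective _ h2 _).finrank_eq.symm
  refine ⟨f, hf0, fun x hx => ?_⟩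
  rw [← hr, ← hr]
  exact hf x hx

theorem torRank_eq_zero {M N : GrMod K n} (hM : M.IsGraded) (hN : N.IsGraded) {i j : ℕ}
    (h : j < i) : torRank M N i j = 0 := by
  have := ((hM.syzIter (i + 1)).grading.tgr hN.grading).fin j
  exact Nat.eq_zero_of_le_zero ((Submodule.finrank_map_le _ _).trans
    (finrank_syzTgr_eq_zero hM hN (Nat.lt_succ_of_lt h)).le)

/-- Semicontinuity of the dimensions of Tor in polynomial families of homogeneous ideals with
constant Hilbert functions. -/
theorem exists_torDim_le (hQ : ∀ x, IsHomog (Q x)) (hJ : ∀ x, IsHomog (J x))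
    (hQl : ∀ d ≤ j, Lifts ev x₀ fun x => degPart (Q x) d)
    (hJl : ∀ d ≤ j, Lifts ev x₀ fun x => degPart (J x) d)
    (hQf : ∀ d ≤ j, ∀ x, Module.finrank K (degPart (Q x) d) =
      Module.finrank K (degPart (Q x₀) d))
    (hJf : ∀ d ≤ j, ∀ x, Module.finrank K (degPart (J x) d) =
      Module.finrank K (degPart (J x₀) d)) :
    ∃ f : MvPolynomial σ K, MvPolynomial.eval (ev x₀) f ≠ 0 ∧
      ∀ x, MvPolynomial.eval (ev x) f ≠ 0 →
        (∀ i, torDim (quotMod (Q x)) (quotMod (J x)) i j ≤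
          torDim (quotMod (Q x₀)) (quotMod (J x₀)) i j) ∧
        ∀ i, torDim (idealMod (Q x)) (quotMod (J x)) i j ≤
          torDim (idealMod (Q x₀)) (quotMod (J x₀)) i j := by
  have hf : ∀ {P : X → Ideal (MvPolynomial (Fin n) K)}, (∀ d ≤ j, ∀ x,
      Module.finrank K (degPart (P x) d) = Module.finrank K (degPart (P x₀) d)) →
      ∀ d ≤ j, ∀ x, (quotMod (P x)).hf d = (quotMod (P x₀)).hf d := by
    intro P h d hd x
    have h1 := hf_quotMod_add (P x) d
    have h2 := hf_quotMod_add (P x₀) d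
    have h3 := h d hd x
    omega
  choose f hf0 hfr using exists_torRank_quotMod_le hQ hJ hQl hJl (hf hQf) (hf hJf)
  choose f' hf0' hfr' using exists_torRank_idealMod_le hQ hJ hQl hJl (hf hJf)
  -- One polynomial serves all `i`: for `i > j` the ranks at `x₀` vanish, because the source of the
  -- differential is zero in degree `j`.
  refine ⟨∏ i ∈ Finset.range (j + 1), (f i * f' i), ?_, fun x hx => ?_⟩
  · rw [map_prod, Finset.prod_ne_zero_iff]
    intro i _
    rw [map_mul]
    exact mul_ne_zero (hf0 i) (hf0' i)
  · rw [map_prod, Finset.prod_ne_zero_iff] at hx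
    have hx' : ∀ i ≤ j,
        MvPolynomial.eval (ev x) (f i) ≠ 0 ∧ MvPolynomial.eval (ev x) (f' i) ≠ 0 := by
      intro i hi
      have := hx i (Finset.mem_range.2 (Nat.lt_succ_of_le hi))
      rw [map_mul] at this
      exact ⟨left_ne_zero_of_mul this, right_ne_zero_of_mul this⟩
    constructor
    · refine torDim_le_of_torRank_le (quotMod_isGraded (hQ x)) (quotMod_isGraded (hJ x))
        (quotMod_isGraded (hQ x₀)) (quotMod_isGraded (hJ x₀)) (fun d hd => hf hQf d hd x)
        (fun d hd => hf hJf d hd x) fun i => ?_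
      rcases le_or_gt i j with hi | hi
      · exact hfr i x (hx' i hi).1
      · rw [torRank_eq_zero (quotMod_isGraded (hQ x₀)) (quotMod_isGraded (hJ x₀)) hi]
        exact Nat.zero_le _
    · refine torDim_le_of_torRank_le (idealMod_isGraded (hQ x)) (quotMod_isGraded (hJ x))
        (idealMod_isGraded (hQ x₀)) (quotMod_isGraded (hJ x₀)) (fun d hd => ?_)
        (fun d hd => hf hJf d hd x) fun i => ?_
      · rw [hf_idealMod, hf_idealMod]
        exact hQf d hd x
      rcases le_or_gt i j with hi | hi
      · exact hfr' i x (hx' i hi).2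
      · rw [torRank_eq_zero (idealMod_isGraded (hQ x₀)) (quotMod_isGraded (hJ x₀)) hi]
        exact Nat.zero_le _

end GenTor

namespace GenTor

variable {K : Type u} [Field K] {n : ℕ}

/-! # The action of the general linear group on ideals -/

theorem mem_actIdeal {g : GL (Fin n) K} {I : Ideal (MvPolynomial (Fin n) K)}
    {f : MvPolynomial (Fin n) K} : f ∈ actIdeal g I ↔ ∃ h ∈ I, coordChange g h = f :=
  Ideal.mem_map_iff_of_surjective (coordChange g) (coordChange_surjective g)

theorem actIdeal_mul (g h : GL (Fin n) K) (I : Ideal (MvPolynomial (Fin n) K)) :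
    actIdeal (g * h) I = actIdeal g (actIdeal h I) := by
  ext f
  simp only [mem_actIdeal, coordChange_mul, AlgHom.comp_apply]
  constructor
  · rintro ⟨p, hp, rfl⟩
    exact ⟨_, ⟨p, hp, rfl⟩, rfl⟩
  · rintro ⟨_, ⟨p, hp, rfl⟩, rfl⟩
    exact ⟨p, hp, rfl⟩

theorem homogeneousComponent_coordChange (g : GL (Fin n) K) (f : MvPolynomial (Fin n) K) (d : ℕ) :
    MvPolynomial.homogeneousComponent d (coordChange g f) =
      coordChange g (MvPolynomial.homogeneousComponent d f) := by
  conv_lhs => rw [← MvPolynomial.sum_homogeneousComponent f]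
  rw [map_sum, map_sum]
  have h : ∀ e, MvPolynomial.homogeneousComponent d
      (coordChange g (MvPolynomial.homogeneousComponent e f)) =
      if d = e then coordChange g (MvPolynomial.homogeneousComponent d f) else 0 := by
    intro e
    rw [MvPolynomial.homogeneousComponent_of_mem
      (coordChange_mem g (MvPolynomial.homogeneousComponent_isHomogeneous e f))]
    split_ifs with hde
    · rw [hde]
    · rfl
  simp only [h, Finset.sum_ite_eq, Finset.mem_range]
  split_ifs with hd
  · rfl
  · rw [MvPolynomial.homogeneousComponent_eq_zero d f (by omega), map_zero]

theorem IsHomog.actIdeal {I : Ideal (MvPolynomial (Fin n) K)} (hI : IsHomog I)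
    (g : GL (Fin n) K) : IsHomog (actIdeal g I) := by
  refine isHomog_of_component_mem fun f hf d => ?_
  obtain ⟨h, hh, rfl⟩ := mem_actIdeal.1 hf
  rw [homogeneousComponent_coordChange]
  exact mem_actIdeal.2 ⟨_, hI.component_mem hh d, rfl⟩

theorem degPart_actIdeal (g : GL (Fin n) K) (I : Ideal (MvPolynomial (Fin n) K)) (d : ℕ) :
    degPart (actIdeal g I) d = (degPart I d).map (coordChange g).toLinearMap := by
  ext f
  constructor
  · rintro ⟨hf, hf'⟩
    obtain ⟨h, hh, rfl⟩ := mem_actIdeal.1 hf'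
    refine ⟨h, ⟨?_, hh⟩, rfl⟩
    rw [← coordChange_inv_apply g h]
    exact coordChange_mem _ hf
  · rintro ⟨h, ⟨hh, hh'⟩, rfl⟩
    exact ⟨coordChange_mem g hh, mem_actIdeal.2 ⟨h, hh', rfl⟩⟩

theorem finrank_degPart_actIdeal (g : GL (Fin n) K) (I : Ideal (MvPolynomial (Fin n) K)) (d : ℕ) :
    Module.finrank K (degPart (actIdeal g I) d) = Module.finrank K (degPart I d) := by
  rw [degPart_actIdeal]
  exact (Submodule.equivMapOfInjective (coordChange g).toLinearMap (coordChange_injective g)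
    (degPart I d)).finrank_eq.symm

/-- The isomorphism `S/I → S/g(I)` induced by `g`. -/
def actQuot (g : GL (Fin n) K) (I : Ideal (MvPolynomial (Fin n) K)) :
    SMap g (quotMod I) (quotMod (actIdeal g I)) where
  toLin := (Ideal.quotientMapₐ (actIdeal g I) (coordChange g) Ideal.le_comap_map).toLinearMap
  map_smul s x := by
    obtain ⟨x, rfl⟩ := Ideal.Quotient.mk_surjective x
    exact congrArg (Ideal.Quotient.mk (actIdeal g I)) (map_mul (coordChange g) s x)
  map_mem := by
    rintro d _ ⟨x, hx, rfl⟩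
    exact ⟨coordChange g x, coordChange_mem g hx, rfl⟩

theorem map_actQuot (g : GL (Fin n) K) (I : Ideal (MvPolynomial (Fin n) K)) (d : ℕ) :
    ((quotMod I).gr d).map (actQuot g I).toLin = (quotMod (actIdeal g I)).gr d := by
  apply le_antisymm
  · rintro _ ⟨x, hx, rfl⟩
    exact (actQuot g I).map_mem d x hx
  · rintro _ ⟨x, hx, rfl⟩
    refine ⟨Ideal.Quotient.mk I (coordChange g⁻¹ x), ⟨_, coordChange_mem _ hx, rfl⟩, ?_⟩
    exact congrArg (Ideal.Quotient.mk (actIdeal g I)) (coordChange_apply_inv g x)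

/-- The isomorphism `I → g(I)` induced by `g`. -/
def actIncl (g : GL (Fin n) K) (I : Ideal (MvPolynomial (Fin n) K)) :
    SMap g (idealMod I) (idealMod (actIdeal g I)) where
  toLin := (coordChange g).toLinearMap.restrict (p := I.restrictScalars K)
    (q := (actIdeal g I).restrictScalars K) fun f hf => mem_actIdeal.2 ⟨f, hf, rfl⟩
  map_smul s x := Subtype.ext (map_mul (coordChange g) s x.1)
  map_mem _ _ hx := coordChange_mem g hx

theorem map_actIncl (g : GL (Fin n) K) (I : Ideal (MvPolynomial (Fin n) K)) (d : ℕ) :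
    ((idealMod I).gr d).map (actIncl g I).toLin = (idealMod (actIdeal g I)).gr d := by
  apply le_antisymm
  · rintro _ ⟨x, hx, rfl⟩
    exact (actIncl g I).map_mem d x hx
  · rintro ⟨f, hf⟩ hfd
    obtain ⟨h, hh, rfl⟩ := mem_actIdeal.1 hf
    refine ⟨⟨h, hh⟩, ?_, rfl⟩
    change h ∈ MvPolynomial.homogeneousSubmodule (Fin n) K d
    rw [← coordChange_inv_apply g h]
    exact coordChange_mem _ hfd

theorem hf_quotMod_congr {I J : Ideal (MvPolynomial (Fin n) K)} {d : ℕ}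
    (h : Module.finrank K (degPart I d) = Module.finrank K (degPart J d)) :
    (quotMod I).hf d = (quotMod J).hf d := by
  have h1 := hf_quotMod_add I d
  have h2 := hf_quotMod_add J d
  omega

/-- A simultaneous change of coordinates preserves Hilbert functions and is surjective, so ranks
cannot grow and Tor cannot drop. This direction is the only one needed. -/
theorem torDim_quotMod_actIdeal_le {I J : Ideal (MvPolynomial (Fin n) K)} (hI : IsHomog I)
    (hJ : IsHomog J) (g : GL (Fin n) K) (i j : ℕ) :
    torDim (quotMod I) (quotMod J) i j ≤
      torDim (quotMod (actIdeal g I)) (quotMod (actIdeal g J)) i j :=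
  torDim_le_of_torRank_le (quotMod_isGraded hI) (quotMod_isGraded hJ)
    (quotMod_isGraded (hI.actIdeal g)) (quotMod_isGraded (hJ.actIdeal g))
    (fun d _ => hf_quotMod_congr (finrank_degPart_actIdeal g I d).symm)
    (fun d _ => hf_quotMod_congr (finrank_degPart_actIdeal g J d).symm)
    (fun i => torRank_le_of_surjective (actQuot g I) (actQuot g J) (quotMod_isGraded hI)
      (quotMod_isGraded (hI.actIdeal g)) (quotMod_isGraded hJ) (map_actQuot g I)
      (map_actQuot g J) i j) i

theorem torDim_idealMod_actIdeal_le {I J : Ideal (MvPolynomial (Fin n) K)} (hI : IsHomog I)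
    (hJ : IsHomog J) (g : GL (Fin n) K) (i j : ℕ) :
    torDim (idealMod I) (quotMod J) i j ≤
      torDim (idealMod (actIdeal g I)) (quotMod (actIdeal g J)) i j :=
  torDim_le_of_torRank_le (idealMod_isGraded hI) (quotMod_isGraded hJ)
    (idealMod_isGraded (hI.actIdeal g)) (quotMod_isGraded (hJ.actIdeal g))
    (fun d _ => by rw [hf_idealMod, hf_idealMod, finrank_degPart_actIdeal])
    (fun d _ => hf_quotMod_congr (finrank_degPart_actIdeal g J d).symm)
    (fun i => torRank_le_of_surjective (actIncl g I) (actQuot g J) (idealMod_isGraded hI)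
      (idealMod_isGraded (hI.actIdeal g)) (quotMod_isGraded hJ) (map_actIncl g I)
      (map_actQuot g J) i j) i

/-! # General linear coordinates -/

/-- The matrix entries of a coordinate change. -/
def entries (g : GL (Fin n) K) : Fin n × Fin n → K := fun p => g p.1 p.2

/-- The coefficients of `g(f)` are polynomials in the entries of `g`. The family is defined on all
matrices, as polynomial maps live on the whole affine space. -/
theorem polyMaps_substitution (f : MvPolynomial (Fin n) K) :
    (fun p : Fin n × Fin n → K => MvPolynomial.aeval (R := K)
      (fun i => ∑ k, MvPolynomial.C (p (k, i)) * MvPolynomial.X (R := K) k) f) ∈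
        polyMaps K (Fin n × Fin n) (MvPolynomial (Fin n) K) := by
  induction f using MvPolynomial.induction_on with
  | C a =>
    simp only [MvPolynomial.algHom_C]
    exact polyMaps_const _
  | add f f' h h' =>
    simp only [map_add]
    exact Submodule.add_mem _ h h'
  | mul_X f i h =>
    simp only [map_mul, MvPolynomial.aeval_X]
    refine polyMaps_bilin (LinearMap.mul K (MvPolynomial (Fin n) K)) h ?_
    have := Submodule.sum_mem (polyMaps K (Fin n × Fin n) (MvPolynomial (Fin n) K))
      (t := Finset.univ) fun k (_ : k ∈ Finset.univ) =>
        polyMaps_smul (MvPolynomial.X (k, i)) (MvPolynomial.X (R := K) k)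
    convert this using 1
    ext1 p
    simp [MvPolynomial.smul_eq_C_mul]

theorem lifts_degPart_actIdeal (I : Ideal (MvPolynomial (Fin n) K)) (d : ℕ) (g₀ : GL (Fin n) K) :
    Lifts entries g₀ fun g => degPart (actIdeal g I) d := by
  intro f hf
  obtain ⟨h, hh, rfl⟩ := (degPart_actIdeal g₀ I d).le hf
  refine ⟨_, polyMaps_substitution h, rfl, fun g => ?_⟩
  beta_reduce
  rw [degPart_actIdeal]
  exact ⟨h, hh, rfl⟩

theorem forGeneral_of_eval_ne_zero {P : GL (Fin n) K → Prop}
    (f : MvPolynomial (Fin n × Fin n) K) {g₀ : GL (Fin n) K}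
    (h₀ : MvPolynomial.eval (entries g₀) f ≠ 0)
    (h : ∀ g, MvPolynomial.eval (entries g) f ≠ 0 → P g) : ForGeneral P := by
  refine ⟨{g | MvPolynomial.eval (entries g) f ≠ 0}, ⟨{f}, ?_⟩, ⟨g₀, h₀⟩, h⟩
  ext g
  simp only [Set.mem_ofPred_eq, Set.mem_singleton_iff, exists_eq_left]
  rfl

theorem ForGeneral.exists_polynomial {P : GL (Fin n) K → Prop} (h : ForGeneral P) :
    ∃ (f : MvPolynomial (Fin n × Fin n) K) (g₀ : GL (Fin n) K),
      MvPolynomial.eval (entries g₀) f ≠ 0 ∧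
        ∀ g, MvPolynomial.eval (entries g) f ≠ 0 → P g := by
  obtain ⟨_, ⟨F, rfl⟩, ⟨g₀, f, hf, h₀⟩, h⟩ := h
  exact ⟨f, g₀, h₀, fun g hg => h g ⟨f, hf, hg⟩⟩

theorem ForGeneral.mono {P Q : GL (Fin n) K → Prop} (hP : ForGeneral P) (h : ∀ g, P g → Q g) :
    ForGeneral Q := by
  obtain ⟨U, hU, hne, hUP⟩ := hP
  exact ⟨U, hU, hne, fun g hg => h g (hUP g hg)⟩

theorem ForGeneral.and [Infinite K] {P Q : GL (Fin n) K → Prop} (hP : ForGeneral P)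
    (hQ : ForGeneral Q) : ForGeneral fun g => P g ∧ Q g := by
  obtain ⟨f, g₁, h₁, hfP⟩ := hP.exists_polynomial
  obtain ⟨f', g₂, h₂, hfQ⟩ := hQ.exists_polynomial
  obtain ⟨g, hg, hg'⟩ := (forGeneral_of_eval_ne_zero f h₁ fun _ h => h).exists_and
    (forGeneral_of_eval_ne_zero f' h₂ fun _ h => h)
  refine forGeneral_of_eval_ne_zero (f * f') (g₀ := g) ?_ fun g hg => ?_
  · rw [map_mul]
    exact mul_ne_zero hg hg'
  · rw [map_mul] at hg
    exact ⟨hfP g (left_ne_zero_of_mul hg), hfQ g (right_ne_zero_of_mul hg)⟩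

theorem ForGeneral.of_forall {P : GL (Fin n) K → Prop} (h : ∀ g, P g) : ForGeneral P :=
  forGeneral_of_eval_ne_zero 1 (g₀ := 1) (by simp) fun g _ => h g

theorem ForGeneral.forall_finset [Infinite K] {ι : Type*} (s : Finset ι)
    {P : ι → GL (Fin n) K → Prop} (h : ∀ i ∈ s, ForGeneral (P i)) :
    ForGeneral fun g => ∀ i ∈ s, P i g := by
  classical
  induction s using Finset.induction_on with
  | empty => exact ForGeneral.of_forall fun g i hi => absurd hi (Finset.notMem_empty i)
  | insert i s _ ih =>
    refine ((h i (Finset.mem_insert_self i s)).and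
      (ih fun k hk => h k (Finset.mem_insert_of_mem hk))).mono fun g hg k hk => ?_
    rcases Finset.mem_insert.1 hk with rfl | hk
    exacts [hg.1, hg.2 k hk]

/-- The dimension of the members of a polynomial family of subspaces is generically constant. -/
theorem forGeneral_finrank_eq {V : Type*} [AddCommGroup V] [Module K V]
    {A : GL (Fin n) K → Submodule K V} (hA : ∀ g₀, Lifts entries g₀ A) {G : Submodule K V}
    [FiniteDimensional K G] (hAG : ∀ g, A g ≤ G) :
    ∃ r, ForGeneral fun g => Module.finrank K (A g) = r := by
  have hne : (Set.range fun g => Module.finrank K (A g)).Nonempty := ⟨_, 1, rfl⟩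
  have hbdd : BddAbove (Set.range fun g => Module.finrank K (A g)) := by
    refine ⟨Module.finrank K G, ?_⟩
    rintro _ ⟨g, rfl⟩
    exact Submodule.finrank_mono (hAG g)
  -- At a matrix where the dimension is maximal, semicontinuity forces equality on a neighbourhood.
  obtain ⟨g₀, hg₀⟩ := Nat.sSup_mem hne hbdd
  obtain ⟨f, hf0, hf⟩ := (hA g₀).finrank_le fun g => Submodule.finiteDimensional_of_le (hAG g)
  refine ⟨_, forGeneral_of_eval_ne_zero f hf0 fun g hg => le_antisymm ?_ (hf g hg)⟩
  rw [show Module.finrank K (A g₀) = _ from hg₀]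
  exact le_csSup hbdd ⟨g, rfl⟩

end GenTor

namespace GenTor

variable {K : Type u} [Field K] {n : ℕ}

/-! # Initial ideals and generic initial ideals -/

/-- An ideal generated by monomials. -/
def IsMonomialIdeal (L : Ideal (MvPolynomial (Fin n) K)) : Prop :=
  ∃ s : Set (Fin n →₀ ℕ), L = Ideal.span ((fun a => MvPolynomial.monomial a (1 : K)) '' s)

theorem IsMonomialIdeal.mem_iff {L : Ideal (MvPolynomial (Fin n) K)} (hL : IsMonomialIdeal L)
    {f : MvPolynomial (Fin n) K} :
    f ∈ L ↔ ∀ a ∈ f.support, MvPolynomial.monomial a (1 : K) ∈ L := by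
  obtain ⟨s, rfl⟩ := hL
  have h : ∀ a : Fin n →₀ ℕ, (MvPolynomial.monomial a (1 : K)).support = {a} := fun a => by
    classical
    exact MvPolynomial.support_monomial.trans (if_neg one_ne_zero)
  simp only [MvPolynomial.mem_ideal_span_monomial_image, h, Finset.mem_singleton, forall_eq]

theorem IsMonomialIdeal.isHomog {L : Ideal (MvPolynomial (Fin n) K)} (hL : IsMonomialIdeal L) :
    IsHomog L := by
  refine isHomog_of_component_mem fun f hf d => ?_
  rw [hL.mem_iff] at hf ⊢
  intro a ha
  rw [MvPolynomial.support_homogeneousComponent] at ha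
  exact hf a (Finset.mem_filter.1 ha).1

theorem initialIdeal_eq_span (m : MonomialOrder (Fin n)) (I : Ideal (MvPolynomial (Fin n) K)) :
    initialIdeal m I = Ideal.span ((fun a => MvPolynomial.monomial a (1 : K)) ''
      (m.degree '' ((I : Set (MvPolynomial (Fin n) K)) \ {0}))) := by
  rw [initialIdeal, MonomialOrder.span_leadingTerm_eq_span_monomial', Set.image_image]

theorem gin_eq_span (m : MonomialOrder (Fin n)) (I : Ideal (MvPolynomial (Fin n) K)) :
    gin m I = Ideal.span ((fun a => MvPolynomial.monomial a (1 : K)) '' {a | ForGeneral fun g =>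
      MvPolynomial.monomial a (1 : K) ∈ initialIdeal m (actIdeal g I)}) := by
  rw [gin]
  congr 1
  ext t
  constructor
  · rintro ⟨a, rfl, ha⟩
    exact ⟨a, ha, rfl⟩
  · rintro ⟨a, ha, rfl⟩
    exact ⟨a, rfl, ha⟩

theorem isMonomialIdeal_gin (m : MonomialOrder (Fin n)) (I : Ideal (MvPolynomial (Fin n) K)) :
    IsMonomialIdeal (gin m I) :=
  ⟨_, gin_eq_span m I⟩

/-- The monomials that generically lie in the initial ideal are closed under multiplication by
monomials, so the ideal they generate contains no further monomials. -/
theorem monomial_mem_gin_iff {m : MonomialOrder (Fin n)} {I : Ideal (MvPolynomial (Fin n) K)}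
    {a : Fin n →₀ ℕ} : MvPolynomial.monomial a (1 : K) ∈ gin m I ↔
      ForGeneral fun g => MvPolynomial.monomial a (1 : K) ∈ initialIdeal m (actIdeal g I) := by
  constructor
  · intro h
    rw [gin_eq_span, MvPolynomial.mem_ideal_span_monomial_image] at h
    obtain ⟨b, hb, hba⟩ := h a (by simp)
    refine ForGeneral.mono hb fun g hg => ?_
    have h2 : MvPolynomial.monomial a (1 : K) =
        MvPolynomial.monomial (a - b) 1 * MvPolynomial.monomial b 1 := by
      rw [MvPolynomial.monomial_mul, one_mul, tsub_add_cancel_of_le hba]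
    rw [h2]
    exact Ideal.mul_mem_left _ _ hg
  · exact fun h => Ideal.subset_span ⟨a, rfl, h⟩

theorem degPart_eq_restrictSupport {L : Ideal (MvPolynomial (Fin n) K)} (hL : IsMonomialIdeal L)
    (d : ℕ) : degPart L d = MvPolynomial.restrictSupport K
      {a : Fin n →₀ ℕ | a.degree = d ∧ MvPolynomial.monomial a (1 : K) ∈ L} := by
  ext f
  rw [degPart, MvPolynomial.homogeneousSubmodule_eq_finsupp_supported]
  constructor
  · rintro ⟨h, h'⟩ a ha
    exact ⟨h ha, hL.mem_iff.1 h' a ha⟩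
  · intro h
    exact ⟨fun a ha => (h ha).1, hL.mem_iff.2 fun a ha => (h ha).2⟩

/-- `x^a` is the leading monomial of a homogeneous element of `A`. -/
def IsLeading (m : MonomialOrder (Fin n)) (A : Ideal (MvPolynomial (Fin n) K))
    (a : Fin n →₀ ℕ) : Prop :=
  ∃ f ∈ degPart A a.degree, f.coeff a = 1 ∧ ∀ b ∈ f.support, b ≠ a → m.toSyn b < m.toSyn a

/-- A monomial of the initial ideal is a multiple of a leading monomial of some `p` in `A`.
Multiplying `p` by the quotient, normalising and taking a homogeneous component gives the witness,
which stays in `A` by homogeneity. -/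
theorem monomial_mem_initialIdeal_iff {m : MonomialOrder (Fin n)}
    {A : Ideal (MvPolynomial (Fin n) K)} (hA : IsHomog A) {a : Fin n →₀ ℕ} :
    MvPolynomial.monomial a (1 : K) ∈ initialIdeal m A ↔ IsLeading m A a := by
  constructor
  · intro h
    rw [initialIdeal_eq_span, MvPolynomial.mem_ideal_span_monomial_image] at h
    obtain ⟨_, ⟨p, ⟨hp, hp0⟩, rfl⟩, hpa⟩ := h a (by simp)
    have hp0' : p ≠ 0 := hp0
    have hlc : m.leadingCoeff p ≠ 0 := m.leadingCoeff_ne_zero_iff.2 hp0'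
    let q := MvPolynomial.monomial (a - m.degree p) (m.leadingCoeff p)⁻¹ * p
    have hmon : MvPolynomial.monomial (a - m.degree p) (m.leadingCoeff p)⁻¹ ≠ 0 := by
      rw [Ne, MvPolynomial.monomial_eq_zero]
      exact inv_ne_zero hlc
    have hqdeg : m.degree q = a := by
      classical
      rw [m.degree_mul hmon hp0', m.degree_monomial, if_neg (inv_ne_zero hlc),
        tsub_add_cancel_of_le hpa]
    have hqc : q.coeff a = 1 := by
      conv_lhs => rw [← hqdeg]
      change m.leadingCoeff q = 1
      rw [m.leadingCoeff_mul, m.leadingCoeff_monomial, inv_mul_cancel₀ hlc]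
    refine ⟨MvPolynomial.homogeneousComponent a.degree q,
      ⟨MvPolynomial.homogeneousComponent_isHomogeneous _ _,
        hA.component_mem (Ideal.mul_mem_left _ _ hp) _⟩, ?_, fun b hb hba => ?_⟩
    · rw [MvPolynomial.coeff_homogeneousComponent, if_pos rfl, hqc]
    · rw [MvPolynomial.support_homogeneousComponent] at hb
      have h2 := m.le_degree (Finset.mem_filter.1 hb).1
      rw [hqdeg] at h2
      exact lt_of_le_of_ne h2 fun h => hba (m.toSyn.injective h)
  · rintro ⟨f, ⟨-, hf⟩, hc, hlt⟩
    have hdeg : m.degree f = a := by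
      apply m.toSyn.injective
      apply le_antisymm
      · rw [m.degree_le_iff]
        intro b hb
        rcases eq_or_ne b a with rfl | hne
        · exact le_rfl
        · exact (hlt b hb hne).le
      · apply m.le_degree
        rw [MvPolynomial.mem_support_iff, hc]
        exact one_ne_zero
    refine Ideal.subset_span ⟨f, hf, ?_⟩
    rw [MonomialOrder.leadingTerm, MonomialOrder.leadingCoeff, hdeg, hc]

/-- The span of the monomials of the same degree as `x^a` that are smaller than `x^a`. -/
def lowerPart (K : Type u) [Field K] (m : MonomialOrder (Fin n)) (a : Fin n →₀ ℕ) :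
    Submodule K (MvPolynomial (Fin n) K) :=
  MvPolynomial.restrictSupport K {b | b.degree = a.degree ∧ m.toSyn b < m.toSyn a}

/-- Turns a condition on leading monomials into membership in a sum of subspaces, which a comparison
of dimensions in a family can decide. -/
theorem isLeading_iff {m : MonomialOrder (Fin n)} {A : Ideal (MvPolynomial (Fin n) K)}
    {a : Fin n →₀ ℕ} : IsLeading m A a ↔
      MvPolynomial.monomial a (1 : K) ∈ degPart A a.degree ⊔ lowerPart K m a := by
  constructor
  · rintro ⟨f, hf, hc, hlt⟩
    have h : f - MvPolynomial.monomial a 1 ∈ lowerPart K m a := by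
      intro b hb
      have hb' : (f - MvPolynomial.monomial a 1).coeff b ≠ 0 := MvPolynomial.mem_support_iff.1 hb
      rw [MvPolynomial.coeff_sub, MvPolynomial.coeff_monomial] at hb'
      have hba : b ≠ a := by
        rintro rfl
        rw [if_pos rfl, hc, sub_self] at hb'
        exact hb' rfl
      rw [if_neg hba.symm, sub_zero] at hb'
      refine ⟨?_, hlt b (MvPolynomial.mem_support_iff.2 hb') hba⟩
      by_contra hd
      exact hb' (MvPolynomial.IsHomogeneous.coeff_eq_zero hf.1 hd)
    have := Submodule.sub_mem _ (Submodule.mem_sup_left hf) (Submodule.mem_sup_right h)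
    rwa [sub_sub_cancel] at this
  · intro h
    obtain ⟨f, hf, l, hl, h⟩ := Submodule.mem_sup.1 h
    have hlc : ∀ b, ¬ m.toSyn b < m.toSyn a → l.coeff b = 0 := by
      intro b hb
      by_contra h0
      exact hb (hl (MvPolynomial.mem_support_iff.2 h0)).2
    have hfc : ∀ b, f.coeff b = (if a = b then 1 else 0) - l.coeff b := by
      intro b
      rw [← MvPolynomial.coeff_monomial, ← h, MvPolynomial.coeff_add, add_sub_cancel_right]
    refine ⟨f, hf, ?_, fun b hb hba => ?_⟩
    · rw [hfc, if_pos rfl, hlc a (lt_irrefl _), sub_zero]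
    · by_contra hlt
      rw [MvPolynomial.mem_support_iff, hfc, if_neg hba.symm, hlc b hlt, sub_zero] at hb
      exact hb rfl

theorem lowerPart_le (m : MonomialOrder (Fin n)) (a : Fin n →₀ ℕ) :
    lowerPart K m a ≤ MvPolynomial.homogeneousSubmodule (Fin n) K a.degree := by
  rw [MvPolynomial.homogeneousSubmodule_eq_finsupp_supported]
  exact fun f hf b hb => (hf hb).1

/-- A monomial lies in the initial ideal of `g(I)` for a general `g`, or it does not lie in the
initial ideal of `g(I)` for a general `g`. -/
theorem forGeneral_monomial_mem_or [Infinite K] {I : Ideal (MvPolynomial (Fin n) K)}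
    (hI : IsHomog I) (m : MonomialOrder (Fin n)) (a : Fin n →₀ ℕ) :
    ForGeneral (fun g => MvPolynomial.monomial a (1 : K) ∈ initialIdeal m (actIdeal g I)) ∨
      ForGeneral fun g => MvPolynomial.monomial a (1 : K) ∉ initialIdeal m (actIdeal g I) := by
  let t := MvPolynomial.monomial a (1 : K)
  let G := MvPolynomial.homogeneousSubmodule (Fin n) K a.degree
  have hG : FiniteDimensional K G := isGrading_homogeneousSubmodule.fin _
  have ht : t ∈ G := MvPolynomial.isHomogeneous_monomial _ rfl
  -- Membership of `t` in `A g` means `A g = B g`. Both dimensions are generically constant, so the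
  -- answer depends only on whether the two generic values agree.
  let A := fun g : GL (Fin n) K => degPart (actIdeal g I) a.degree ⊔ lowerPart K m a
  let B := fun g : GL (Fin n) K => A g ⊔ Submodule.span K {t}
  have hA : ∀ g₀, Lifts entries g₀ A := fun g₀ =>
    (lifts_degPart_actIdeal I _ g₀).sup (Lifts.const _)
  have hB : ∀ g₀, Lifts entries g₀ B := fun g₀ => (hA g₀).sup (Lifts.const _)
  have hAG : ∀ g, A g ≤ G := fun g => sup_le inf_le_left (lowerPart_le m a)
  have hBG : ∀ g, B g ≤ G := fun g =>
    sup_le (hAG g) ((Submodule.span_singleton_le_iff_mem _ _).2 ht)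
  have hiff : ∀ g, t ∈ initialIdeal m (actIdeal g I) ↔ t ∈ A g := fun g => by
    rw [monomial_mem_initialIdeal_iff (hI.actIdeal g), isLeading_iff]
  obtain ⟨r, hr⟩ := forGeneral_finrank_eq hA hAG
  obtain ⟨s, hs⟩ := forGeneral_finrank_eq hB hBG
  have hrs := hr.and hs
  by_cases h : r = s
  · refine Or.inl (hrs.mono fun g hg => (hiff g).2 ?_)
    have : FiniteDimensional K (B g) := Submodule.finiteDimensional_of_le (hBG g)
    have h1 : A g = B g := Submodule.eq_of_le_of_finrank_eq le_sup_left (by rw [hg.1, hg.2, h])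
    rw [h1]
    exact Submodule.mem_sup_right (Submodule.mem_span_singleton_self t)
  · refine Or.inr (hrs.mono fun g hg hmem => h ?_)
    have h1 : B g = A g :=
      sup_eq_left.2 ((Submodule.span_singleton_le_iff_mem _ _).2 ((hiff g).1 hmem))
    rw [← hg.1, ← hg.2, h1]

/-- In bounded degrees the generic initial ideal agrees with the initial ideal of `g(I)` for some
`g`. -/
theorem exists_gin_eq [Infinite K] {I : Ideal (MvPolynomial (Fin n) K)} (hI : IsHomog I)
    (m : MonomialOrder (Fin n)) (j : ℕ) :
    ∃ g : GL (Fin n) K, ∀ a : Fin n →₀ ℕ, a.degree ≤ j →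
      (MvPolynomial.monomial a (1 : K) ∈ gin m I ↔ IsLeading m (actIdeal g I) a) := by
  have key : ∀ a : Fin n →₀ ℕ, ForGeneral fun g : GL (Fin n) K =>
      (MvPolynomial.monomial a (1 : K) ∈ gin m I ↔ IsLeading m (actIdeal g I) a) := by
    intro a
    simp only [← monomial_mem_initialIdeal_iff (hI.actIdeal _), monomial_mem_gin_iff]
    rcases forGeneral_monomial_mem_or hI m a with h | h
    · exact h.mono fun g hg => iff_of_true h hg
    · refine h.mono fun g hg => iff_of_false (fun h' => ?_) hg
      obtain ⟨g', h1, h2⟩ := h.exists_and h'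
      exact h1 h2
  have := ForGeneral.forall_finset (Finsupp.finite_of_degree_le (σ := Fin n) j).toFinset
    fun a _ => key a
  obtain ⟨g, hg, -⟩ := this.exists_and this
  exact ⟨g, fun a ha => hg a ((Finsupp.finite_of_degree_le j).mem_toFinset.2 ha)⟩

end GenTor

namespace GenTor

variable {K : Type u} [Field K] {n : ℕ}

/-! # Degeneration to initial ideals -/

/-- The diagonal matrix with entries `t^{w_i}`. -/
def diagGL (w : Fin n → ℕ) (t : K) (ht : t ≠ 0) : GL (Fin n) K :=
  Matrix.GeneralLinearGroup.mkOfDetNeZero (Matrix.diagonal fun i => t ^ w i) (by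
    rw [Matrix.det_diagonal]
    exact Finset.prod_ne_zero_iff.2 fun i _ => pow_ne_zero _ ht)

theorem coordChange_diagGL_X (w : Fin n → ℕ) {t : K} (ht : t ≠ 0) (i : Fin n) :
    coordChange (diagGL w t ht) (MvPolynomial.X i) =
      MvPolynomial.C (t ^ w i) * MvPolynomial.X i := by
  rw [coordChange_X, Finset.sum_eq_single i]
  · rw [show (diagGL w t ht) i i = t ^ w i from Matrix.diagonal_apply_eq _ i]
  · intro k _ hk
    rw [show (diagGL w t ht) k i = 0 from Matrix.diagonal_apply_ne _ hk, map_zero, zero_mul]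
  · exact fun h => absurd (Finset.mem_univ i) h

theorem coordChange_diagGL_monomial (w : Fin n → ℕ) {t : K} (ht : t ≠ 0) (b : Fin n →₀ ℕ)
    (c : K) : coordChange (diagGL w t ht) (MvPolynomial.monomial b c) =
      t ^ (∑ i, b i * w i) • MvPolynomial.monomial b c := by
  rw [MvPolynomial.monomial_eq, map_mul, MvPolynomial.algHom_C, MvPolynomial.algebraMap_eq,
    Finsupp.prod_fintype _ _ (fun i => pow_zero _), map_prod, ← Finset.prod_pow_eq_pow_sum]
  simp only [map_pow, coordChange_diagGL_X, mul_pow, Finset.prod_mul_distrib,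
    MvPolynomial.smul_eq_C_mul, map_prod, ← pow_mul, mul_comm (w _)]
  ring

variable (m : MonomialOrder (Fin n)) (w : Fin n → ℕ) (A L : Ideal (MvPolynomial (Fin n) K))

/-- The family with special member `L` whose other members are the images of `A` under a
one-parameter group. -/
def degeneration (t : K) : Ideal (MvPolynomial (Fin n) K) :=
  open Classical in
  if h : t = 0 then L else actIdeal (diagGL w t⁻¹ (inv_ne_zero h)) A

theorem degeneration_zero : degeneration w A L 0 = L :=
  dif_pos rfl

theorem degeneration_of_ne {t : K} (ht : t ≠ 0) :
    degeneration w A L t = actIdeal (diagGL w t⁻¹ (inv_ne_zero ht)) A :=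
  dif_neg ht

variable {m w A L} {j : ℕ}

theorem isHomog_degeneration (hA : IsHomog A) (hL : IsHomog L) (t : K) :
    IsHomog (degeneration w A L t) := by
  rcases eq_or_ne t 0 with rfl | ht
  · rwa [degeneration_zero]
  · rw [degeneration_of_ne w A L ht]
    exact hA.actIdeal _

/-- If `f` in `A` has leading monomial `x^a`, scaling the variables by `t^{-w_i}` and multiplying by
`t^{wt a}` replaces each term of weight `wt b` by `t^{wt a - wt b}` times itself. This is polynomial
in `t`, and at `t = 0` only `x^a` survives. -/
theorem lifts_degeneration
    (hw : ∀ a b : Fin n →₀ ℕ, a.degree ≤ j → b.degree ≤ j → m.toSyn b < m.toSyn a →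
      ∑ i, b i * w i < ∑ i, a i * w i)
    (hL : IsMonomialIdeal L)
    (hLA : ∀ a : Fin n →₀ ℕ, a.degree ≤ j → MvPolynomial.monomial a (1 : K) ∈ L →
      IsLeading m A a) {d : ℕ} (hd : d ≤ j) :
    Lifts (fun t (_ : Unit) => t) 0 fun t => degPart (degeneration w A L t) d := by
  refine Lifts.of_span ((fun a => MvPolynomial.monomial a (1 : K)) ''
    {a : Fin n →₀ ℕ | a.degree = d ∧ MvPolynomial.monomial a (1 : K) ∈ L}) ?_ ?_
  · rw [degeneration_zero, degPart_eq_restrictSupport hL]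
    intro f hf
    rw [f.as_sum]
    refine Submodule.sum_mem _ fun a ha => ?_
    have := Submodule.smul_mem (Submodule.span K ((fun a => MvPolynomial.monomial a (1 : K)) ''
      {a : Fin n →₀ ℕ | a.degree = d ∧ MvPolynomial.monomial a (1 : K) ∈ L})) (f.coeff a)
      (Submodule.subset_span ⟨a, hf ha, rfl⟩)
    rwa [MvPolynomial.smul_monomial, smul_eq_mul, mul_one] at this
  · rintro _ ⟨a, ⟨rfl, ha⟩, rfl⟩
    obtain ⟨f, hf, hc, hlt⟩ := hLA a hd ha
    let wt := fun b : Fin n →₀ ℕ => ∑ i, b i * w i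
    have hdeg : ∀ b ∈ f.support, b.degree = a.degree := by
      intro b hb
      by_contra hne
      exact MvPolynomial.mem_support_iff.1 hb (MvPolynomial.IsHomogeneous.coeff_eq_zero hf.1 hne)
    have hlt' : ∀ b ∈ f.support, b ≠ a → wt b < wt a := fun b hb hba =>
      hw a b hd ((hdeg b hb).trans_le hd) (hlt b hb hba)
    -- The truncated subtraction is harmless: `wt b ≤ wt a` on the support of `f`, strictly for `b ≠
    -- a`.
    let c : (Unit → K) → MvPolynomial (Fin n) K := fun p => ∑ b ∈ f.support,
      MvPolynomial.eval p (MvPolynomial.X () ^ (wt a - wt b)) • MvPolynomial.monomial b (f.coeff b)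
    have hcp : c ∈ polyMaps K Unit (MvPolynomial (Fin n) K) := by
      have : c = ∑ b ∈ f.support, fun p => MvPolynomial.eval p
          (MvPolynomial.X () ^ (wt a - wt b)) • MvPolynomial.monomial b (f.coeff b) := by
        ext1 p
        rw [Finset.sum_apply]
      rw [this]
      exact Submodule.sum_mem _ fun b _ => polyMaps_smul _ _
    have hc0 : c (fun _ => 0) = MvPolynomial.monomial a 1 := by
      have haf : a ∈ f.support := by
        rw [MvPolynomial.mem_support_iff, hc]
        exact one_ne_zero
      change ∑ b ∈ f.support, _ = _
      rw [Finset.sum_eq_single_of_mem a haf]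
      · rw [Nat.sub_self, pow_zero, map_one, one_smul, hc]
      · intro b hb hba
        rw [map_pow, MvPolynomial.eval_X, zero_pow (Nat.sub_ne_zero_of_lt (hlt' b hb hba)),
          zero_smul]
    refine ⟨c, hcp, hc0, fun t => ?_⟩
    rcases eq_or_ne t 0 with rfl | ht
    · rw [hc0, degeneration_zero]
      exact ⟨MvPolynomial.isHomogeneous_monomial _ rfl, ha⟩
    · rw [degeneration_of_ne w A L ht, degPart_actIdeal]
      refine ⟨t ^ wt a • f, Submodule.smul_mem _ _ hf, ?_⟩
      change coordChange _ (t ^ wt a • f) = ∑ b ∈ f.support, _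
      rw [map_smul]
      conv_lhs => rw [f.as_sum]
      rw [map_sum, Finset.smul_sum]
      refine Finset.sum_congr rfl fun b hb => ?_
      have hle : wt b ≤ wt a := by
        rcases eq_or_ne b a with rfl | hne
        · exact le_rfl
        · exact (hlt' b hb hne).le
      rw [coordChange_diagGL_monomial, smul_smul, map_pow, MvPolynomial.eval_X, inv_pow,
        pow_sub₀ t ht hle]

theorem exists_ne_zero_eval_ne_zero [Infinite K] {f : MvPolynomial Unit K}
    (hf : MvPolynomial.eval (fun _ => (0 : K)) f ≠ 0) :
    ∃ t : K, t ≠ 0 ∧ MvPolynomial.eval (fun _ => t) f ≠ 0 := by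
  -- The extra factor `X` excludes the special parameter 0.
  have hne : f * MvPolynomial.X () ≠ 0 := by
    refine mul_ne_zero ?_ (MvPolynomial.X_ne_zero _)
    rintro rfl
    exact hf (map_zero _)
  obtain ⟨v, hv⟩ : ∃ v, MvPolynomial.eval v (f * MvPolynomial.X ()) ≠ 0 := by
    by_contra! h
    exact hne (MvPolynomial.funext fun v => by simpa using h v)
  rw [map_mul, MvPolynomial.eval_X] at hv
  exact ⟨v (), right_ne_zero_of_mul hv, left_ne_zero_of_mul hv⟩

/-- Let `T` be spanned by the degree `d` monomials outside `L`. It meets `A_d` trivially, since the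
leading monomial of a nonzero common element would lie in `L`; and together with `L_d` it spans
`S_d`. -/
theorem finrank_degPart_le_of_isLeading (hL : IsMonomialIdeal L) {d : ℕ}
    (hLA : ∀ a : Fin n →₀ ℕ, a.degree = d → IsLeading m A a →
      MvPolynomial.monomial a (1 : K) ∈ L) :
    Module.finrank K (degPart A d) ≤ Module.finrank K (degPart L d) := by
  let S := MvPolynomial.homogeneousSubmodule (Fin n) K d
  have hS : FiniteDimensional K S := isGrading_homogeneousSubmodule.fin _
  let T : Submodule K (MvPolynomial (Fin n) K) := MvPolynomial.restrictSupport K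
    {a : Fin n →₀ ℕ | a.degree = d ∧ MvPolynomial.monomial a (1 : K) ∉ L}
  have hTS : T ≤ S := by
    change _ ≤ MvPolynomial.homogeneousSubmodule (Fin n) K d
    rw [MvPolynomial.homogeneousSubmodule_eq_finsupp_supported]
    exact fun f hf b hb => (hf hb).1
  have hfT : FiniteDimensional K T := Submodule.finiteDimensional_of_le hTS
  have hfA : FiniteDimensional K (degPart A d) := Submodule.finiteDimensional_of_le inf_le_left
  have hfL : FiniteDimensional K (degPart L d) := Submodule.finiteDimensional_of_le inf_le_left
  have hdisj : degPart A d ⊓ T = ⊥ := by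
    rw [eq_bot_iff]
    rintro f ⟨hfA, hfT⟩
    by_contra hf0
    rw [Submodule.mem_bot] at hf0
    have hlc : m.leadingCoeff f ≠ 0 := m.leadingCoeff_ne_zero_iff.2 hf0
    have hmem := hfT (m.degree_mem_support hf0)
    refine hmem.2 (hLA _ hmem.1 ⟨(m.leadingCoeff f)⁻¹ • f, ?_, ?_, fun b hb hne => ?_⟩)
    · rw [hmem.1]
      exact Submodule.smul_mem _ _ hfA
    · rw [MvPolynomial.coeff_smul, smul_eq_mul]
      exact inv_mul_cancel₀ hlc
    · have hb' : b ∈ f.support := MvPolynomial.support_smul hb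
      exact lt_of_le_of_ne (m.le_degree hb') fun h => hne (m.toSyn.injective h)
  have hsup : S ≤ degPart L d ⊔ T := by
    intro f hf
    rw [f.as_sum]
    refine Submodule.sum_mem _ fun a ha => ?_
    have had : a.degree = d := by
      by_contra hne
      exact MvPolynomial.mem_support_iff.1 ha (MvPolynomial.IsHomogeneous.coeff_eq_zero hf hne)
    have hsupp : (↑(MvPolynomial.monomial a (f.coeff a)).support : Set (Fin n →₀ ℕ)) ⊆ {a} := by
      intro b hb
      have := MvPolynomial.support_monomial_subset hb
      simpa using this
    by_cases haL : MvPolynomial.monomial a (1 : K) ∈ L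
    · refine Submodule.mem_sup_left ?_
      rw [degPart_eq_restrictSupport hL]
      intro b hb
      rw [Set.mem_singleton_iff.1 (hsupp hb)]
      exact ⟨had, haL⟩
    · refine Submodule.mem_sup_right fun b hb => ?_
      rw [Set.mem_singleton_iff.1 (hsupp hb)]
      exact ⟨had, haL⟩
  have h1 := Submodule.finrank_sup_add_finrank_inf_eq (degPart A d) T
  have h2 := Submodule.finrank_sup_add_finrank_inf_eq (degPart L d) T
  have h3 : Module.finrank K (degPart A d ⊔ T : Submodule K _) ≤ Module.finrank K S :=
    Submodule.finrank_mono (sup_le inf_le_left hTS)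
  have h4 : Module.finrank K S ≤ Module.finrank K (degPart L d ⊔ T : Submodule K _) :=
    Submodule.finrank_mono hsup
  rw [hdisj, finrank_bot] at h1
  omega

/-- Members with `t ≠ 0` all have the Hilbert function of `A`. One inequality with `L` is the count
by leading monomials; the other is semicontinuity at 0, evaluated at some nonzero parameter. -/
theorem finrank_degPart_degeneration [Infinite K]
    (hw : ∀ a b : Fin n →₀ ℕ, a.degree ≤ j → b.degree ≤ j → m.toSyn b < m.toSyn a →
      ∑ i, b i * w i < ∑ i, a i * w i)
    (hL : IsMonomialIdeal L)
    (hLA : ∀ a : Fin n →₀ ℕ, a.degree ≤ j → (MvPolynomial.monomial a (1 : K) ∈ L ↔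
      IsLeading m A a)) {d : ℕ} (hd : d ≤ j) (t : K) :
    Module.finrank K (degPart (degeneration w A L t) d) =
      Module.finrank K (degPart (degeneration w A L 0) d) := by
  have hne : ∀ {t : K}, t ≠ 0 → Module.finrank K (degPart (degeneration w A L t) d) =
      Module.finrank K (degPart A d) := by
    intro t ht
    rw [degeneration_of_ne w A L ht, finrank_degPart_actIdeal]
  rcases eq_or_ne t 0 with rfl | ht
  · rfl
  apply le_antisymm
  · rw [hne ht, degeneration_zero]
    exact finrank_degPart_le_of_isLeading hL fun a ha h => (hLA a (ha.trans_le hd)).2 h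
  · have hS : FiniteDimensional K (MvPolynomial.homogeneousSubmodule (Fin n) K d) :=
      isGrading_homogeneousSubmodule.fin _
    obtain ⟨f, hf0, hf⟩ := (lifts_degeneration hw hL (fun a ha => (hLA a ha).1) hd).finrank_le
      fun t => Submodule.finiteDimensional_of_le (inf_le_left :
        degPart (degeneration w A L t) d ≤ MvPolynomial.homogeneousSubmodule (Fin n) K d)
    obtain ⟨s, hs, hfs⟩ := exists_ne_zero_eval_ne_zero hf0
    have := hf s hfs
    rw [hne hs] at this
    rwa [hne ht]

/-- Weights that decrease fast enough along an ordering of the variables represent the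
lexicographic order in bounded degrees. -/
theorem weight_lt_weight {r : Fin n → Fin n → Prop} (hr : ∀ i k, k ≠ i → r k i ∨ r i k)
    (hw0 : ∀ i, 0 < w i) (hw : ∀ i k, r i k → (j + 1) * w k ≤ w i) {a b : Fin n →₀ ℕ}
    (hb : b.degree ≤ j) (h : ∃ i, (∀ k, r k i → b k = a k) ∧ b i < a i) :
    ∑ i, b i * w i < ∑ i, a i * w i := by
  classical
  obtain ⟨i, hi, hlt⟩ := h
  have h1 : ∑ k ∈ Finset.univ.erase i, b k * w k ≤
      ∑ k ∈ Finset.univ.erase i, a k * w k + ∑ k ∈ Finset.univ.erase i with r i k, b k * w k := by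
    rw [Finset.sum_filter, ← Finset.sum_add_distrib]
    refine Finset.sum_le_sum fun k hk => ?_
    rcases hr i k (Finset.ne_of_mem_erase hk) with h | h
    · rw [hi k h]
      exact Nat.le_add_right _ _
    · rw [if_pos h]
      exact Nat.le_add_left _ _
  -- Each variable after `i` weighs at most `w i / (j + 1)` and `b` has degree at most `j`, so
  -- together they contribute less than `w i`, the least gain from `b i < a i`.
  have h2 : (j + 1) * ∑ k ∈ Finset.univ.erase i with r i k, b k * w k ≤ j * w i := by
    rw [Finset.mul_sum]
    calc ∑ k ∈ Finset.univ.erase i with r i k, (j + 1) * (b k * w k)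
        ≤ ∑ k ∈ Finset.univ.erase i with r i k, b k * w i := by
          refine Finset.sum_le_sum fun k hk => ?_
          rw [mul_left_comm]
          exact Nat.mul_le_mul_left _ (hw i k (Finset.mem_filter.1 hk).2)
      _ ≤ ∑ k, b k * w i := Finset.sum_le_sum_of_subset (Finset.subset_univ _)
      _ = b.degree * w i := by rw [← Finset.sum_mul, Finsupp.degree_eq_sum]
      _ ≤ j * w i := Nat.mul_le_mul_right _ hb
  have h3 : ∑ k ∈ Finset.univ.erase i with r i k, b k * w k < w i := by
    have h4 : (j + 1) * ∑ k ∈ Finset.univ.erase i with r i k, b k * w k < (j + 1) * w i := by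
      have := hw0 i
      nlinarith
    exact Nat.lt_of_mul_lt_mul_left h4
  have h5 : b i * w i + w i ≤ a i * w i := by
    rw [← Nat.succ_mul]
    exact Nat.mul_le_mul_right _ hlt
  rw [← Finset.add_sum_erase _ _ (Finset.mem_univ i),
    ← Finset.add_sum_erase _ _ (Finset.mem_univ i)]
  omega

theorem exists_weight_lex (n j : ℕ) : ∃ w : Fin n → ℕ, ∀ a b : Fin n →₀ ℕ, a.degree ≤ j →
    b.degree ≤ j → (MonomialOrder.lex (σ := Fin n)).toSyn b < MonomialOrder.lex.toSyn a →
      ∑ i, b i * w i < ∑ i, a i * w i := by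
  -- The exponent decreases with the index, so `x_0` is heaviest; the ratio `j + 1` beats the degree
  -- bound `j`.
  refine ⟨fun i => (j + 1) ^ (n - i.1), fun a b _ hb h => ?_⟩
  refine weight_lt_weight (r := fun i k => i < k) (fun i k h => lt_or_gt_of_ne h)
    (fun i => by positivity) (fun i k hik => ?_) hb (lex_lt_iff.1 h)
  rw [← pow_succ']
  refine Nat.pow_le_pow_right (Nat.succ_pos j) ?_
  have := k.2
  have : i.1 < k.1 := hik
  omega

theorem exists_weight_oplex (n j : ℕ) : ∃ w : Fin n → ℕ, ∀ a b : Fin n →₀ ℕ, a.degree ≤ j →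
    b.degree ≤ j → (oplex n).toSyn b < (oplex n).toSyn a →
      ∑ i, b i * w i < ∑ i, a i * w i := by
  refine ⟨fun i => (j + 1) ^ i.1, fun a b _ hb h => ?_⟩
  refine weight_lt_weight (r := fun i k => k < i) (fun i k h => (lt_or_gt_of_ne h).symm)
    (fun i => by positivity) (fun i k hik => ?_) hb (oplex_lt_iff.1 h)
  rw [← pow_succ']
  exact Nat.pow_le_pow_right (Nat.succ_pos j) hik

end GenTor

end

/-! ### The main theorem -/

theorem theorem2p5 {K : Type u} [Field K] [Infinite K] {n : ℕ}
    (I J : Ideal (MvPolynomial (Fin n) K))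
    (hI : GenTor.IsHomog I) (hJ : GenTor.IsHomog J) (j : ℕ) :
    GenTor.ForGeneral fun g : GL (Fin n) K =>
      (∀ i : ℕ,
        GenTor.torDim (GenTor.quotMod I) (GenTor.quotMod (GenTor.actIdeal g J)) i j ≤
          GenTor.torDim (GenTor.quotMod (GenTor.gin MonomialOrder.lex I))
            (GenTor.quotMod (GenTor.gin (GenTor.oplex n) J)) i j) ∧
      (∀ i : ℕ,
        GenTor.torDim (GenTor.idealMod I) (GenTor.quotMod (GenTor.actIdeal g J)) i j ≤
          GenTor.torDim (GenTor.idealMod (GenTor.gin MonomialOrder.lex I))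
            (GenTor.quotMod (GenTor.gin (GenTor.oplex n) J)) i j) := by
  obtain ⟨h₁, hh₁⟩ := GenTor.exists_gin_eq hI MonomialOrder.lex j
  obtain ⟨h₂, hh₂⟩ := GenTor.exists_gin_eq hJ (GenTor.oplex n) j
  obtain ⟨w₁, hw₁⟩ := GenTor.exists_weight_lex n j
  obtain ⟨w₂, hw₂⟩ := GenTor.exists_weight_oplex n j
  have hL₁ := GenTor.isMonomialIdeal_gin MonomialOrder.lex I
  have hL₂ := GenTor.isMonomialIdeal_gin (GenTor.oplex n) J
  -- Both ideals degenerate along the same parameter `t`, each with its own weights, so one line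
  -- carries both limits.
  obtain ⟨f, hf0, hf⟩ := GenTor.exists_torDim_le (j := j)
    (GenTor.isHomog_degeneration (w := w₁) (hI.actIdeal h₁) hL₁.isHomog)
    (GenTor.isHomog_degeneration (w := w₂) (hJ.actIdeal h₂) hL₂.isHomog)
    (fun d hd => GenTor.lifts_degeneration hw₁ hL₁ (fun a ha => (hh₁ a ha).1) hd)
    (fun d hd => GenTor.lifts_degeneration hw₂ hL₂ (fun a ha => (hh₂ a ha).1) hd)
    (fun d hd => GenTor.finrank_degPart_degeneration hw₁ hL₁ hh₁ hd)
    (fun d hd => GenTor.finrank_degPart_degeneration hw₂ hL₂ hh₂ hd)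
  obtain ⟨t, ht, hft⟩ := GenTor.exists_ne_zero_eval_ne_zero hf0
  have ht' := hf t hft
  rw [GenTor.degeneration_of_ne _ _ _ ht, GenTor.degeneration_of_ne _ _ _ ht,
    GenTor.degeneration_zero, GenTor.degeneration_zero, ← GenTor.actIdeal_mul,
    ← GenTor.actIdeal_mul] at ht'
  set u₁ := GenTor.diagGL w₁ t⁻¹ (inv_ne_zero ht) * h₁
  set u₂ := GenTor.diagGL w₂ t⁻¹ (inv_ne_zero ht) * h₂
  -- Only the relative position of the two coordinate systems matters: factoring out `u₁` restores
  -- `I` itself as the first ideal.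
  have hu : GenTor.actIdeal u₂ J = GenTor.actIdeal u₁ (GenTor.actIdeal (u₁⁻¹ * u₂) J) := by
    rw [← GenTor.actIdeal_mul, mul_inv_cancel_left]
  rw [hu] at ht'
  have hJ₀ := hJ.actIdeal (u₁⁻¹ * u₂)
  -- The second use of semicontinuity takes `I` constant and moves `g(J)` over the general linear
  -- group, with the matrix just found as special point.
  obtain ⟨F, hF0, hF⟩ := GenTor.exists_torDim_le (j := j) (ev := GenTor.entries) (x₀ := u₁⁻¹ * u₂)
    (Q := fun _ => I) (J := fun g => GenTor.actIdeal g J) (fun _ => hI) (fun g => hJ.actIdeal g)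
    (fun d _ => GenTor.Lifts.const _) (fun d _ => GenTor.lifts_degPart_actIdeal J d _)
    (fun _ _ _ => rfl)
    (fun d _ g => by rw [GenTor.finrank_degPart_actIdeal, GenTor.finrank_degPart_actIdeal])
  refine GenTor.forGeneral_of_eval_ne_zero F hF0 fun g hg => ⟨fun i => ?_, fun i => ?_⟩
  · exact ((hF g hg).1 i).trans ((GenTor.torDim_quotMod_actIdeal_le hI hJ₀ u₁ i j).trans (ht'.1 i))
  · exact ((hF g hg).2 i).trans ((GenTor.torDim_idealMod_actIdeal_le hI hJ₀ u₁ i j).trans (ht'.2 i))
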